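/- **Setting.** Let $f:[0,\infty)\times\mathbb R^n\times\mathbb R^m\to\mathbb R^n$ and $l:[0,\infty)\times\mathbb R^n\times\mathbb R^m\to\mathbb R$ be continuous, let $\delta>0$, and let $\Omega\subset\mathbb R^m$ be non-empty and compact. Suppose that there are $K_1,K_2>0$ such that, for all $t\ge 0$, $u\in\Omega$ and $x,z\in\mathbb R^n$, $$|l(t,x,u)-l(t,z,u)|+|f(t,x,u)-f(t,z,u)|\le K_1|x-z|,\qquad |l(t,x,u)|+|f(t,x,u)|\le K_2(1+|x|),$$ and that $\{(e^{-\delta t}l(t,x,v),f(t,x,v)) : v\in\Omega\}\subset\mathbb R^{n+1}$ is convex for all $t\ge0$, $x\in\mathbb R^n$. For $(s,z)\in[0,\infty)\times\mathbb R^n$, an *admissible process* from $(s,z)$ is a pair $(x,u)$ with $u\in L^1_{loc}([s,\infty);\mathbb R^m)$, $u(t)\in\Omega$ for a.e. $t\ge s$, and $x(t)=z+\int_s^t f(r,x(r),u(r))\,dr$ for all $t\ge s$ (with locally integrable integrand). Let $\mathcal D_{s,z;\infty}$ be the set of those whose cost $\int_s^\infty e^{-\delta t}l(t,x(t),u(t))\,dt$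 exists as a finite Lebesgue integral. Put $$\mathcal H(t,x,\xi)=\inf_{u\in\Omega}\{\langle\xi,f(t,x,u)\rangle+e^{-\delta t}l(t,x,u)\},\qquad \hat{\mathcal H}(t,x,\xi)=\sup_{u\in\Omega}\{\langle\xi,f(t,x,u)\rangle+e^{-\delta t}l(t,x,u)\}.$$ For $\varphi:[0,\infty)\times\mathbb R^n\to\mathbb R$, let $\partial_P\varphi(t,x)$ be the set of $(\alpha,\xi)\in\mathbb R\times\mathbb R^n$ for which there are $\sigma>0$ and a neighbourhood $U$ of $(t,x)$ in $[0,\infty)\times\mathbb R^n$ with $$\varphi(\tau,y)\ge\varphi(t,x)+\alpha(\tau-t)+\langle\xi,y-x\rangle-\sigma(|\tau-t|^2+|y-x|^2)\quad\text{for all }(\tau,y)\in U.$$ Infima and suprema over $\partial_P\varphi$ are taken in $[-\infty,\infty]$, with $\inf\emptyset=+\infty$, $\sup\emptyset=-\infty$. **Proposition.** Let $\varphi:[0,\infty)\times\mathbb R^n\to\mathbb R$ be continuous and, for $(x,u)\in\mathcal D_{s,z;\infty}$, put $$G_{x,u}:[s,\infty)\to\mathbb R,\qquad G_{x,u}(t)=\varphi(t,x(t))-\int_t^\infty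 e^{-\delta\sigma}l(\sigma,x(\sigma),u(\sigma))\,d\sigma .$$ (a) Consider the statements - (a1) for all $(s,z)\in[0,\infty)\times\mathbb R^n$ and every $(x,u)\in\mathcal D_{s,z;\infty}$, $G_{x,u}$ is non-decreasing; - (a2) $\inf_{(\alpha,\xi)\in\partial_P\varphi(s,z)}\{\alpha+\mathcal H(s,z,\xi)\}\ge0$ for all $(s,z)\in(0,\infty)\times\mathbb R^n$. Then (a2) implies (a1); and (a1) implies (a2) if $\mathcal D_{\tau,y;\infty}\ne\emptyset$ for all $(\tau,y)\in[0,\infty)\times\mathbb R^n$. (b) Consider the statements - (b1) for all $(s,z)\in[0,\infty)\times\mathbb R^n$ and every $(x,u)\in\mathcal D_{s,z;\infty}$, $G_{x,u}$ is non-increasing; - (b2) $\sup_{(\alpha,\xi)\in\partial_P\varphi(s,z)}\{\alpha+\hat{\mathcal H}(s,z,\xi)\}\le0$ for all $(s,z)\in[0,\infty)\times\mathbb R^n$. Then (b2) implies (b1); and (b1) implies (b2) if $\mathcal D_{\tau,y;\infty}\ne\emptyset$ for all $(\tau,y)\in[0,\infty)\times\mathbb R^n$. (c) Consider the statements - (c1)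 for all $(s,z)\in[0,\infty)\times\mathbb R^n$ there is $(x,u)\in\mathcal D_{s,z;\infty}$ for which $G_{x,u}$ is non-increasing; - (c2) $\sup_{(\alpha,\xi)\in\partial_P\varphi(s,z)}\{\alpha+\mathcal H(s,z,\xi)\}\le0$ for all $(s,z)\in[0,\infty)\times\mathbb R^n$. Then (c1) implies (c2); and (c2) implies (c1) if every admissible process from every $(\tau,y)\in[0,\infty)\times\mathbb R^n$ has finite cost, i.e. belongs to $\mathcal D_{\tau,y;\infty}$. In particular, if every admissible process has finite cost, then all three equivalences (a1)$\Leftrightarrow$(a2), (b1)$\Leftrightarrow$(b2), (c1)$\Leftrightarrow$(c2) hold. -/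

import Mathlib

open Set Filter Topology MeasureTheory

/-- Data of the infinite horizon optimal control problem with states in `ℝⁿ` and controls in `ℝᵐ`.
Only times `t ≥ 0` are ever used; the values of `f`, `l` at negative times are irrelevant. -/
structure ControlProblem (n m : ℕ) where
  /-- the dynamics -/
  f : ℝ → EuclideanSpace ℝ (Fin n) → EuclideanSpace ℝ (Fin m) → EuclideanSpace ℝ (Fin n)
  /-- the running cost -/
  l : ℝ → EuclideanSpace ℝ (Fin n) → EuclideanSpace ℝ (Fin m) → ℝ
  /-- the set of admissible control actions -/
  Ω : Set (EuclideanSpace ℝ (Fin m))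
  /-- the discount rate -/
  δ : ℝ

namespace ControlProblem

variable {n m : ℕ}

/-- The standing assumptions on the data. -/
structure Standing (P : ControlProblem n m) : Prop where
  discount_pos : 0 < P.δ
  controls_nonempty : P.Ω.Nonempty
  lipschitz : ∃ K₁ : ℝ, 0 < K₁ ∧ ∀ t : ℝ, 0 ≤ t → ∀ u ∈ P.Ω, ∀ x z : EuclideanSpace ℝ (Fin n),
    |P.l t x u - P.l t z u| + ‖P.f t x u - P.f t z u‖ ≤ K₁ * ‖x - z‖
  growth : ∃ K₂ : ℝ, 0 < K₂ ∧ ∀ t : ℝ, 0 ≤ t → ∀ x : EuclideanSpace ℝ (Fin n), ∀ u ∈ P.Ω,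
    |P.l t x u| + ‖P.f t x u‖ ≤ K₂ * (1 + ‖x‖)
  continuous_l : ContinuousOn
    (fun p : ℝ × EuclideanSpace ℝ (Fin n) × EuclideanSpace ℝ (Fin m) => P.l p.1 p.2.1 p.2.2)
    {p | 0 ≤ p.1}
  continuous_f : ContinuousOn
    (fun p : ℝ × EuclideanSpace ℝ (Fin n) × EuclideanSpace ℝ (Fin m) => P.f p.1 p.2.1 p.2.2)
    {p | 0 ≤ p.1}
  convex_velocities : ∀ t : ℝ, 0 ≤ t → ∀ x : EuclideanSpace ℝ (Fin n),
    Convex ℝ ((fun v => (Real.exp (-P.δ * t) * P.l t x v, P.f t x v)) '' P.Ω)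
  compact_controls : IsCompact P.Ω

/-- `(x, u)` is an admissible process starting at time `τ` in the state `z`: the control `u` is
locally integrable on `[τ, ∞)` with values in `Ω` almost everywhere, and `x` solves the state
equation in integral form on `[τ, ∞)`. Local integrability of the right-hand side makes `x`
absolutely continuous on compact intervals. -/
structure IsAdmissible (P : ControlProblem n m) (τ : ℝ) (z : EuclideanSpace ℝ (Fin n))
    (x : ℝ → EuclideanSpace ℝ (Fin n)) (u : ℝ → EuclideanSpace ℝ (Fin m)) : Prop where
  control_locallyIntegrable : LocallyIntegrableOn u (Ici τ)
  control_mem : ∀ᵐ t ∂(volume.restrict (Ici τ)), u t ∈ P.Ω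
  velocity_locallyIntegrable : LocallyIntegrableOn (fun r => P.f r (x r) (u r)) (Ici τ)
  state_eq : ∀ t, τ ≤ t → x t = z + ∫ r in τ..t, P.f r (x r) (u r)

/-- The discounted running cost along a process. -/
noncomputable def discountedCost (P : ControlProblem n m)
    (x : ℝ → EuclideanSpace ℝ (Fin n)) (u : ℝ → EuclideanSpace ℝ (Fin m)) (t : ℝ) : ℝ :=
  Real.exp (-P.δ * t) * P.l t (x t) (u t)

/-- The set of admissible processes from `(τ, z)` with finite cost, that is, whose cost integral
over `[τ, ∞)` exists (as a Lebesgue integral) and is finite. -/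
def finiteCostProcesses (P : ControlProblem n m) (τ : ℝ) (z : EuclideanSpace ℝ (Fin n)) :
    Set ((ℝ → EuclideanSpace ℝ (Fin n)) × (ℝ → EuclideanSpace ℝ (Fin m))) :=
  {p | P.IsAdmissible τ z p.1 p.2 ∧ IntegrableOn (P.discountedCost p.1 p.2) (Ioi τ)}

/-- The function `t ↦ φ(t, x(t)) - ∫_t^∞ e^{-δσ} l(σ, x(σ), u(σ)) dσ`. -/
noncomputable def pathValue (P : ControlProblem n m) (φ : ℝ → EuclideanSpace ℝ (Fin n) → ℝ)
    (x : ℝ → EuclideanSpace ℝ (Fin n)) (u : ℝ → EuclideanSpace ℝ (Fin m)) (t : ℝ) : ℝ :=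
  φ t (x t) - ∫ σ in Ioi t, P.discountedCost x u σ

/-- The Hamilton function `H(t, x, ξ, u) = ⟨ξ, f(t, x, u)⟩ + e^{-δt} l(t, x, u)`. -/
noncomputable def preHamiltonian (P : ControlProblem n m) (t : ℝ)
    (x ξ : EuclideanSpace ℝ (Fin n)) (u : EuclideanSpace ℝ (Fin m)) : ℝ :=
  inner ℝ ξ (P.f t x u) + Real.exp (-P.δ * t) * P.l t x u

/-- The minimised Hamiltonian. -/
noncomputable def hamiltonian (P : ControlProblem n m) (t : ℝ)
    (x ξ : EuclideanSpace ℝ (Fin n)) : ℝ :=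
  sInf (P.preHamiltonian t x ξ '' P.Ω)

/-- The maximised Hamiltonian. -/
noncomputable def maxHamiltonian (P : ControlProblem n m) (t : ℝ)
    (x ξ : EuclideanSpace ℝ (Fin n)) : ℝ :=
  sSup (P.preHamiltonian t x ξ '' P.Ω)

end ControlProblem

/-- The proximal sub-gradient at `(t, x)` of a function `φ` with domain `[0, ∞) × ℝⁿ`.
Neighbourhoods are taken in that domain. -/
def proximalSubgradient {n : ℕ} (φ : ℝ → EuclideanSpace ℝ (Fin n) → ℝ) (t : ℝ)
    (x : EuclideanSpace ℝ (Fin n)) : Set (ℝ × EuclideanSpace ℝ (Fin n)) :=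
  {p | ∃ σ : ℝ, 0 < σ ∧
    ∀ᶠ q : ℝ × EuclideanSpace ℝ (Fin n) in 𝓝[{q | 0 ≤ q.1}] (t, x),
      φ t x + p.1 * (q.1 - t) + inner ℝ p.2 (q.2 - x)
        - σ * (|q.1 - t| ^ 2 + ‖q.2 - x‖ ^ 2) ≤ φ q.1 q.2}

namespace ControlProblem

variable {n m : ℕ}

/-- `inf {α + 𝓗(s, z, ξ) | (α, ξ) ∈ ∂_P φ(s, z)}`, an extended real (`⊤` on the empty set). -/
noncomputable def infHJB (P : ControlProblem n m) (φ : ℝ → EuclideanSpace ℝ (Fin n) → ℝ)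
    (s : ℝ) (z : EuclideanSpace ℝ (Fin n)) : EReal :=
  ⨅ p ∈ proximalSubgradient φ s z, ((p.1 + P.hamiltonian s z p.2 : ℝ) : EReal)

/-- `sup {α + 𝓗(s, z, ξ) | (α, ξ) ∈ ∂_P φ(s, z)}`, an extended real (`⊥` on the empty set). -/
noncomputable def supHJB (P : ControlProblem n m) (φ : ℝ → EuclideanSpace ℝ (Fin n) → ℝ)
    (s : ℝ) (z : EuclideanSpace ℝ (Fin n)) : EReal :=
  ⨆ p ∈ proximalSubgradient φ s z, ((p.1 + P.hamiltonian s z p.2 : ℝ) : EReal)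

/-- The same supremum with the maximised Hamiltonian. -/
noncomputable def supMaxHJB (P : ControlProblem n m) (φ : ℝ → EuclideanSpace ℝ (Fin n) → ℝ)
    (s : ℝ) (z : EuclideanSpace ℝ (Fin n)) : EReal :=
  ⨆ p ∈ proximalSubgradient φ s z, ((p.1 + P.maxHamiltonian s z p.2 : ℝ) : EReal)

/-- From every initial condition, non-decreasing along every process with finite cost. -/
def NondecreasingAlongEvery (P : ControlProblem n m)
    (φ : ℝ → EuclideanSpace ℝ (Fin n) → ℝ) : Prop :=
  ∀ s : ℝ, 0 ≤ s → ∀ z : EuclideanSpace ℝ (Fin n), ∀ p ∈ P.finiteCostProcesses s z,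
    MonotoneOn (P.pathValue φ p.1 p.2) (Ici s)

/-- From every initial condition, non-increasing along every process with finite cost. -/
def NonincreasingAlongEvery (P : ControlProblem n m)
    (φ : ℝ → EuclideanSpace ℝ (Fin n) → ℝ) : Prop :=
  ∀ s : ℝ, 0 ≤ s → ∀ z : EuclideanSpace ℝ (Fin n), ∀ p ∈ P.finiteCostProcesses s z,
    AntitoneOn (P.pathValue φ p.1 p.2) (Ici s)

/-- From every initial condition, non-increasing along some process with finite cost. -/
def NonincreasingAlongSome (P : ControlProblem n m)
    (φ : ℝ → EuclideanSpace ℝ (Fin n) → ℝ) : Prop :=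
  ∀ s : ℝ, 0 ≤ s → ∀ z : EuclideanSpace ℝ (Fin n), ∃ p ∈ P.finiteCostProcesses s z,
    AntitoneOn (P.pathValue φ p.1 p.2) (Ici s)

end ControlProblem

/-! Since `φ` is only continuous, it cannot be differentiated along a process. The passage from a
Hamilton–Jacobi inequality to monotonicity therefore replaces `φ` on a compact cylinder by a
quadratic inf-convolution `V` (`exists_infConvolution`). It is uniformly close to `φ`, and at every
point of the cylinder it lies below a touching paraboloid whose slope `(α, ξ)` is a proximal
subgradient of `φ` at a nearby minimiser `(τ, y)`. The Hamiltonians at the two points differ by at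
most `ε`, uniformly in the control. Hence over a short time step `V` plus the accumulated cost grows
by at most the integral of `α + ⟨ξ, f⟩ + e^{-δt} l`, up to `ε` times the length.

This one-sided estimate holds for steps in both time directions. Forward steps give (b). Backward
steps reverse the sign of the integral and give (a), so subgradients suffice for both. Time zero may
be left out of (a2) because monotonicity on `(s, ∞)` extends to `s` by continuity.

For (c), the control at each Euler node is chosen to minimise the Hamiltonian at `(τ, y)` rather
than at the node itself (`exists_isEulerPolygon_le`). The polygons, augmented by their cost,
converge to a locally Lipschitz curve. Convexity of the velocity sets puts its derivative into the
velocity set almost everywhere, and a measurable selection recovers a control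
(`exists_measurable_zero_selection`).

For the converses, the proximal inequality is inserted into the monotonicity along a process,
divided by the elapsed time, and the time increment tends to zero
(`eventually_integral_le_of_pathValue_le`). In (a) and (b), processes that use a constant control
near the point realise the value of the Hamiltonian at any prescribed control: arriving at the point
for (a), whence `s > 0`, and leaving it for (b). -/

namespace ControlProblem

/-! ### Velocities and Hamiltonians: continuity, growth, extrema -/

variable {n m : ℕ} {P : ControlProblem n m}

/-- The discounted cost rate together with the velocity. -/
noncomputable def velocity (P : ControlProblem n m) (t : ℝ) (x : EuclideanSpace ℝ (Fin n))
    (u : EuclideanSpace ℝ (Fin m)) : ℝ × EuclideanSpace ℝ (Fin n) :=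
  (Real.exp (-P.δ * t) * P.l t x u, P.f t x u)

lemma preHamiltonian_eq_velocity (t : ℝ) (x ξ : EuclideanSpace ℝ (Fin n))
    (u : EuclideanSpace ℝ (Fin m)) :
    P.preHamiltonian t x ξ u = inner ℝ ξ (P.velocity t x u).2 + (P.velocity t x u).1 := rfl

lemma abs_preHamiltonian_sub_le (t t' : ℝ) (x x' ξ : EuclideanSpace ℝ (Fin n))
    (u : EuclideanSpace ℝ (Fin m)) :
    |P.preHamiltonian t x ξ u - P.preHamiltonian t' x' ξ u| ≤
      ‖ξ‖ * ‖(P.velocity t x u).2 - (P.velocity t' x' u).2‖ +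
        |(P.velocity t x u).1 - (P.velocity t' x' u).1| := by
  rw [preHamiltonian_eq_velocity, preHamiltonian_eq_velocity]
  have h : inner ℝ ξ (P.velocity t x u).2 + (P.velocity t x u).1 -
      (inner ℝ ξ (P.velocity t' x' u).2 + (P.velocity t' x' u).1) =
      inner ℝ ξ ((P.velocity t x u).2 - (P.velocity t' x' u).2) +
        ((P.velocity t x u).1 - (P.velocity t' x' u).1) := by
    rw [inner_sub_right]; ring
  rw [h]
  exact (abs_add_le _ _).trans (add_le_add (abs_real_inner_le_norm _ _) le_rfl)

namespace Standing

lemma continuousOn_velocity (hP : P.Standing) : ContinuousOn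
    (fun p : ℝ × EuclideanSpace ℝ (Fin n) × EuclideanSpace ℝ (Fin m) =>
      P.velocity p.1 p.2.1 p.2.2) {p | 0 ≤ p.1} := by
  refine ContinuousOn.prodMk (ContinuousOn.mul ?_ hP.continuous_l) hP.continuous_f
  exact Continuous.continuousOn (by fun_prop)

lemma continuous_velocity_control (hP : P.Standing) {t : ℝ} (ht : 0 ≤ t)
    (x : EuclideanSpace ℝ (Fin n)) : Continuous (P.velocity t x) := by
  have h := hP.continuousOn_velocity.comp
    (f := fun u : EuclideanSpace ℝ (Fin m) => (t, x, u)) (s := univ)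
    (Continuous.continuousOn (by fun_prop)) (fun u _ => ht)
  exact continuousOn_univ.mp h

lemma continuous_preHamiltonian_control (hP : P.Standing) {t : ℝ} (ht : 0 ≤ t)
    (x ξ : EuclideanSpace ℝ (Fin n)) : Continuous (P.preHamiltonian t x ξ) := by
  have h := hP.continuous_velocity_control ht x
  exact (continuous_const.inner h.snd).add h.fst

lemma exists_norm_velocity_le (hP : P.Standing) : ∃ K : ℝ, 0 < K ∧ ∀ t : ℝ, 0 ≤ t →
    ∀ x : EuclideanSpace ℝ (Fin n), ∀ u ∈ P.Ω, ‖P.velocity t x u‖ ≤ K * (1 + ‖x‖) := by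
  obtain ⟨K, hK, h⟩ := hP.growth
  refine ⟨K, hK, fun t ht x u hu => ?_⟩
  have h1 := h t ht x u hu
  have h2 : Real.exp (-P.δ * t) ≤ 1 :=
    Real.exp_le_one_iff.mpr (by nlinarith [hP.discount_pos])
  have h3 : |Real.exp (-P.δ * t) * P.l t x u| ≤ |P.l t x u| := by
    rw [abs_mul, abs_of_pos (Real.exp_pos _)]
    exact mul_le_of_le_one_left (abs_nonneg _) h2
  refine max_le ?_ ?_
  · exact h3.trans (by linarith [norm_nonneg (P.f t x u)])
  · change ‖P.f t x u‖ ≤ _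
    linarith [abs_nonneg (P.l t x u)]

/-- Uniform continuity of the velocities on bounded sets, uniformly in the control. -/
lemma exists_velocity_modulus (hP : P.Standing) (T R : ℝ) {ε : ℝ} (hε : 0 < ε) :
    ∃ η : ℝ, 0 < η ∧ ∀ t ∈ Icc 0 T, ∀ t' ∈ Icc 0 T, ∀ x x' : EuclideanSpace ℝ (Fin n),
      ‖x‖ ≤ R → ‖x'‖ ≤ R → |t - t'| < η → ‖x - x'‖ < η → ∀ u ∈ P.Ω,
        ‖P.velocity t x u - P.velocity t' x' u‖ ≤ ε := by
  have hK : IsCompact (Icc 0 T ×ˢ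
      (Metric.closedBall (0 : EuclideanSpace ℝ (Fin n)) R ×ˢ P.Ω)) :=
    isCompact_Icc.prod ((isCompact_closedBall _ _).prod hP.compact_controls)
  have hc := hK.uniformContinuousOn_of_continuous
    (hP.continuousOn_velocity.mono fun p hp => hp.1.1)
  obtain ⟨η, hη, h⟩ := Metric.uniformContinuousOn_iff.mp hc ε hε
  refine ⟨η, hη, fun t ht t' ht' x x' hx hx' htt hxx u hu => ?_⟩
  have := h (t, x, u) ⟨ht, by simpa using hx, hu⟩ (t', x', u) ⟨ht', by simpa using hx', hu⟩ (by
    rw [Prod.dist_eq, Prod.dist_eq, dist_self, Real.dist_eq, dist_eq_norm]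
    exact max_lt htt (max_lt hxx hη))
  rw [dist_eq_norm] at this
  exact this.le

lemma hamiltonian_le (hP : P.Standing) {t : ℝ} (ht : 0 ≤ t)
    (x ξ : EuclideanSpace ℝ (Fin n)) {u : EuclideanSpace ℝ (Fin m)} (hu : u ∈ P.Ω) :
    P.hamiltonian t x ξ ≤ P.preHamiltonian t x ξ u :=
  csInf_le (hP.compact_controls.image (hP.continuous_preHamiltonian_control ht x ξ)).bddBelow
    (mem_image_of_mem _ hu)

lemma le_maxHamiltonian (hP : P.Standing) {t : ℝ} (ht : 0 ≤ t)
    (x ξ : EuclideanSpace ℝ (Fin n)) {u : EuclideanSpace ℝ (Fin m)} (hu : u ∈ P.Ω) :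
    P.preHamiltonian t x ξ u ≤ P.maxHamiltonian t x ξ :=
  le_csSup (hP.compact_controls.image (hP.continuous_preHamiltonian_control ht x ξ)).bddAbove
    (mem_image_of_mem _ hu)

lemma exists_preHamiltonian_eq_hamiltonian (hP : P.Standing) {t : ℝ} (ht : 0 ≤ t)
    (x ξ : EuclideanSpace ℝ (Fin n)) :
    ∃ u ∈ P.Ω, P.preHamiltonian t x ξ u = P.hamiltonian t x ξ :=
  (hP.compact_controls.image (hP.continuous_preHamiltonian_control ht x ξ)).sInf_mem
    (hP.controls_nonempty.image _)

lemma maxHamiltonian_le (hP : P.Standing) {t c : ℝ} {x ξ : EuclideanSpace ℝ (Fin n)}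
    (h : ∀ u ∈ P.Ω, P.preHamiltonian t x ξ u ≤ c) : P.maxHamiltonian t x ξ ≤ c :=
  csSup_le (hP.controls_nonempty.image _) (forall_mem_image.mpr h)

/-! ### Inf-convolution and proximal subgradients -/

/-- Quadratic inf-convolution of `φ` on a bounded set, with separate weights in time and space
chosen so that the Hamiltonian at a base point and at the associated minimiser are close. -/
lemma exists_infConvolution (hP : P.Standing) {φ : ℝ → EuclideanSpace ℝ (Fin n) → ℝ}
    (hφ : ContinuousOn (fun q : ℝ × EuclideanSpace ℝ (Fin n) => φ q.1 q.2) {q | 0 ≤ q.1})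
    {T R ε : ℝ} (hT : 0 ≤ T) (hR : 0 ≤ R) (hε : 0 < ε) :
    ∃ (V : ℝ → EuclideanSpace ℝ (Fin n) → ℝ) (C : ℝ), 0 ≤ C ∧ ∀ t ∈ Icc 0 T, ∀ x, ‖x‖ ≤ R →
      |V t x - φ t x| ≤ ε ∧ ∃ τ y, ∃ p ∈ proximalSubgradient φ τ y, 0 ≤ τ ∧ |t - τ| < ε ∧
        ‖p.2‖ ≤ C ∧
        (∀ u ∈ P.Ω, |P.preHamiltonian t x p.2 u - P.preHamiltonian τ y p.2 u| ≤ ε) ∧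
        ∀ t' x', V t' x' ≤
          V t x + p.1 * (t' - t) + inner ℝ p.2 (x' - x) + C * (|t' - t| ^ 2 + ‖x' - x‖ ^ 2) := by
  -- The cylinder exceeds the region of base points by one, so minimisers stay off its outer
  -- boundary. The face at time zero is harmless, since subgradients are relative to `[0, ∞) × ℝⁿ`.
  set K : Set (ℝ × EuclideanSpace ℝ (Fin n)) := Icc 0 (T + 1) ×ˢ Metric.closedBall 0 (R + 1)
    with hKdef
  have hK : IsCompact K := isCompact_Icc.prod (isCompact_closedBall _ _)
  have hKne : K.Nonempty := ⟨(0, 0), ⟨⟨le_rfl, by linarith⟩, by simp; linarith⟩⟩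
  have hφK : ContinuousOn (fun q : ℝ × EuclideanSpace ℝ (Fin n) => φ q.1 q.2) K :=
    hφ.mono fun q hq => hq.1.1
  obtain ⟨M, hM⟩ := hK.exists_bound_of_continuousOn hφK
  have hM0 : 0 ≤ M := (norm_nonneg _).trans (hM _ hKne.some_mem)
  obtain ⟨K₁, hK₁, hLip⟩ := hP.lipschitz
  -- The bound `ε` controls `V - φ`. The bound `ε / (6 * K₁)` controls the penalty `σ ‖x - y‖ ^ 2`,
  -- which is at most `φ t x - φ τ y` and later absorbs the Lipschitz error.
  obtain ⟨η₀, hη₀, hmodφ⟩ := Metric.uniformContinuousOn_iff.mp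
    (hK.uniformContinuousOn_of_continuous hφK) (min ε (ε / (6 * K₁))) (by positivity)
  obtain ⟨η₁, hη₁, hmod₁⟩ := hP.exists_velocity_modulus (T + 1) (R + 1) (ε := ε / 3) (by positivity)
  set η := min η₀ (min η₁ 1) with hη
  have hηpos : 0 < η := by positivity
  -- As `|φ| ≤ M`, each penalty is at most `2 * M`; this weight forces the minimiser within `η` of
  -- `x`. The weight `ρ` plays the same role for time, with `θ`.
  set σ := (2 * M + 1) / η ^ 2 with hσ
  have hσpos : 0 < σ := by positivity
  -- The dynamics are merely continuous in time, while `ξ` may be as large as `2 * σ`. The time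
  -- modulus is therefore taken at a scale depending on `σ`, and the time weight `ρ` is fixed only
  -- afterwards.
  obtain ⟨η₂, hη₂, hmod₂⟩ := hP.exists_velocity_modulus (T + 1) (R + 1) (ε := ε / (6 * σ))
    (by positivity)
  set θ := min η (min η₂ ε) with hθ
  have hθpos : 0 < θ := by positivity
  set ρ := (2 * M + 1) / θ ^ 2 with hρ
  have hρpos : 0 < ρ := by positivity
  have hmin : ∀ (t : ℝ) (x : EuclideanSpace ℝ (Fin n)), ∃ q ∈ K, ∀ q' ∈ K,
      φ q.1 q.2 + ρ * (t - q.1) ^ 2 + σ * ‖x - q.2‖ ^ 2 ≤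
        φ q'.1 q'.2 + ρ * (t - q'.1) ^ 2 + σ * ‖x - q'.2‖ ^ 2 := by
    intro t x
    have hc : ContinuousOn (fun q : ℝ × EuclideanSpace ℝ (Fin n) =>
        φ q.1 q.2 + ρ * (t - q.1) ^ 2 + σ * ‖x - q.2‖ ^ 2) K :=
      (hφK.add (Continuous.continuousOn (by fun_prop))).add
        (Continuous.continuousOn (by fun_prop))
    obtain ⟨q, hq, h⟩ := hK.exists_isMinOn hKne hc
    exact ⟨q, hq, fun q' hq' => h hq'⟩
  choose q hqK hqmin using hmin
  refine ⟨fun t x => φ (q t x).1 (q t x).2 + ρ * (t - (q t x).1) ^ 2 + σ * ‖x - (q t x).2‖ ^ 2,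
    2 * σ + ρ, by positivity, fun t ht x hx => ?_⟩
  have htxK : (t, x) ∈ K := ⟨⟨ht.1, by linarith [ht.2]⟩, by simp; linarith⟩
  have hqtx := hqK t x
  have hmint := hqmin t x (t, x) htxK
  set τ := (q t x).1 with hτ
  set y := (q t x).2 with hy
  simp only [sub_self, norm_zero] at hmint
  have hφτ : |φ τ y| ≤ M := hM _ hqtx
  have hφt : |φ t x| ≤ M := hM _ htxK
  have hσM : σ * ‖x - y‖ ^ 2 ≤ 2 * M := by
    have : 0 ≤ ρ * (t - τ) ^ 2 := by positivity
    linarith [abs_le.mp hφτ, abs_le.mp hφt]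
  have hρM : ρ * (t - τ) ^ 2 ≤ 2 * M := by
    have : 0 ≤ σ * ‖x - y‖ ^ 2 := by positivity
    linarith [abs_le.mp hφτ, abs_le.mp hφt]
  have hxy : ‖x - y‖ < η := by
    by_contra! hc
    have h1 : σ * η ^ 2 ≤ σ * ‖x - y‖ ^ 2 := by gcongr
    rw [hσ, div_mul_cancel₀ _ (by positivity), ← hσ] at h1
    linarith
  have htτ : |t - τ| < θ := by
    by_contra! hc
    have h1 : ρ * θ ^ 2 ≤ ρ * |t - τ| ^ 2 := by gcongr
    rw [hρ, div_mul_cancel₀ _ (by positivity), ← hρ, sq_abs] at h1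
    linarith
  have hη0 : η ≤ η₀ := min_le_left _ _
  have hη1 : η ≤ η₁ := (min_le_right _ _).trans (min_le_left _ _)
  have hηone : η ≤ 1 := (min_le_right _ _).trans (min_le_right _ _)
  have hθη : θ ≤ η := min_le_left _ _
  have hθ2 : θ ≤ η₂ := (min_le_right _ _).trans (min_le_left _ _)
  have hθε : θ ≤ ε := (min_le_right _ _).trans (min_le_right _ _)
  have hτ0 : 0 ≤ τ := hqtx.1.1
  have hτT : τ ∈ Icc 0 (T + 1) := hqtx.1
  have htT : t ∈ Icc 0 (T + 1) := htxK.1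
  have hyR : ‖y‖ ≤ R + 1 := by simpa using hqtx.2
  have hφdiff : |φ t x - φ τ y| < min ε (ε / (6 * K₁)) := by
    have := hmodφ (t, x) htxK (q t x) hqtx (by
      rw [Prod.dist_eq, Real.dist_eq, dist_eq_norm]
      exact max_lt (by linarith) (by linarith))
    rwa [Real.dist_eq] at this
  have hφ1 := hφdiff.trans_le (min_le_left _ _)
  have hφ2 := hφdiff.trans_le (min_le_right _ _)
  have hρ0 : 0 ≤ ρ * (t - τ) ^ 2 := by positivity
  have hσ0 : 0 ≤ σ * ‖x - y‖ ^ 2 := by positivity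
  refine ⟨?_, τ, y, (2 * ρ * (t - τ), (2 * σ) • (x - y)), ?_, hτ0, by linarith, ?_, ?_, ?_⟩
  · rw [abs_le]
    constructor <;> simp only [← hτ, ← hy] <;> linarith [abs_lt.mp hφ1]
  · refine ⟨ρ + σ, by positivity, ?_⟩
    have hev : ∀ᶠ q' : ℝ × EuclideanSpace ℝ (Fin n) in 𝓝 (τ, y),
        q'.1 < T + 1 ∧ ‖q'.2‖ < R + 1 := by
      have h1 : τ < T + 1 := by linarith [abs_lt.mp htτ, ht.2]
      have h2 : ‖y‖ < R + 1 := by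
        have := norm_sub_norm_le y x
        rw [norm_sub_rev] at this
        linarith
      exact ((continuous_fst.tendsto _).eventually (gt_mem_nhds h1)).and
        ((continuous_snd.norm.tendsto _).eventually (gt_mem_nhds h2))
    filter_upwards [nhdsWithin_le_nhds hev, self_mem_nhdsWithin] with q' hq' hq'0
    have hq'K : q' ∈ K := ⟨⟨hq'0, hq'.1.le⟩, by simpa using hq'.2.le⟩
    have h := hqmin t x q' hq'K
    have hexp : ‖x - q'.2‖ ^ 2 =
        ‖x - y‖ ^ 2 - 2 * inner ℝ (x - y) (q'.2 - y) + ‖q'.2 - y‖ ^ 2 := by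
      rw [← norm_sub_sq_real]; congr 2; abel
    rw [hexp] at h
    simp only [← hτ, ← hy] at h
    rw [sq_abs, inner_smul_left]
    simp only [conj_trivial]
    linarith [mul_nonneg hσpos.le (sq_nonneg (q'.1 - τ)),
      mul_nonneg hρpos.le (sq_nonneg ‖q'.2 - y‖)]
  · simp only
    rw [norm_smul, Real.norm_of_nonneg (by positivity)]
    have : 2 * σ * ‖x - y‖ ≤ 2 * σ * 1 := by gcongr; linarith
    linarith
  -- Three errors of `ε / 3`: the cost rate, the time shift of `f` multiplied by `‖ξ‖`, and the
  -- space shift of `f`, where `‖ξ‖ * K₁ * ‖x - y‖` is `2 * K₁` times the penalty.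
  · intro u hu
    refine (abs_preHamiltonian_sub_le _ _ _ _ _ _).trans ?_
    have h1 := hmod₁ t htT τ hτT x y (by linarith) hyR (by linarith) (by linarith) u hu
    have h2 := hmod₂ t htT τ hτT x x (by linarith) (by linarith) (by linarith) (by simpa) u hu
    have h1' : |(P.velocity t x u).1 - (P.velocity τ y u).1| ≤ ε / 3 :=
      (norm_fst_le (P.velocity t x u - P.velocity τ y u)).trans h1
    have h2' : ‖(P.velocity t x u).2 - (P.velocity τ x u).2‖ ≤ ε / (6 * σ) :=
      (norm_snd_le (P.velocity t x u - P.velocity τ x u)).trans h2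
    have h3 : ‖(P.velocity τ x u).2 - (P.velocity τ y u).2‖ ≤ K₁ * ‖x - y‖ := by
      have := hLip τ hτ0 u hu x y
      change ‖P.f τ x u - P.f τ y u‖ ≤ _
      linarith [abs_nonneg (P.l τ x u - P.l τ y u)]
    have h4 := norm_sub_le_norm_sub_add_norm_sub (P.velocity t x u).2 (P.velocity τ x u).2
      (P.velocity τ y u).2
    simp only
    rw [norm_smul, Real.norm_of_nonneg (by positivity)]
    have h5 : ‖(P.velocity t x u).2 - (P.velocity τ y u).2‖ ≤ ε / (6 * σ) + K₁ * ‖x - y‖ := by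
      linarith
    have h6 : 2 * σ * ‖x - y‖ * ‖(P.velocity t x u).2 - (P.velocity τ y u).2‖ ≤
        2 * σ * ‖x - y‖ * (ε / (6 * σ)) + 2 * K₁ * (σ * ‖x - y‖ ^ 2) :=
      (mul_le_mul_of_nonneg_left h5 (by positivity)).trans (by ring_nf; rfl)
    have h7 : 2 * σ * ‖x - y‖ * (ε / (6 * σ)) = ‖x - y‖ * (ε / 3) := by field_simp; ring
    have h8 : ‖x - y‖ * (ε / 3) ≤ 1 * (ε / 3) := by gcongr; linarith
    have h9 : 2 * K₁ * (σ * ‖x - y‖ ^ 2) ≤ 2 * K₁ * (ε / (6 * K₁)) := by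
      gcongr; linarith [abs_lt.mp hφ2]
    have h10 : 2 * K₁ * (ε / (6 * K₁)) = ε / 3 := by field_simp; ring
    linarith
  -- The minimiser belonging to `(t, x)` is a competitor at `(t', x')`; expanding the squares yields
  -- the paraboloid.
  · intro t' x'
    have h := hqmin t' x' (q t x) hqtx
    simp only [← hτ, ← hy] at h ⊢
    have hexp : ‖x' - y‖ ^ 2 =
        ‖x - y‖ ^ 2 + 2 * inner ℝ (x - y) (x' - x) + ‖x' - x‖ ^ 2 := by
      rw [← norm_add_sq_real]; congr 2; abel
    rw [hexp] at h
    rw [sq_abs, inner_smul_left]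
    simp only [conj_trivial]
    linarith [mul_nonneg hσpos.le (sq_nonneg (t' - t)),
      mul_nonneg hρpos.le (sq_nonneg ‖x' - x‖), mul_nonneg hσpos.le (sq_nonneg ‖x' - x‖)]

end Standing

end ControlProblem

/-! ### Increment bounds and short-time estimates along a process -/

/-- An increment bound proportional to the length holds on an interval as soon as it holds on all
sufficiently short subintervals. -/
lemma sub_le_mul_of_forall_short {F : ℝ → ℝ} {a b c η : ℝ} (hab : a ≤ b) (hη : 0 < η)
    (h : ∀ t ∈ Icc a b, ∀ t' ∈ Icc a b, t ≤ t' → t' - t < η → F t' - F t ≤ c * (t' - t)) :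
    F b - F a ≤ c * (b - a) := by
  obtain ⟨N, hN⟩ := exists_nat_gt ((b - a) / η)
  have hN0 : (0 : ℝ) < N := (div_nonneg (by linarith) hη.le).trans_lt hN
  set d := (b - a) / N with hd
  have hd0 : 0 ≤ d := div_nonneg (by linarith) hN0.le
  have hdη : d < η := by
    rw [hd, div_lt_iff₀ hN0]
    rwa [div_lt_iff₀ hη, mul_comm] at hN
  have hNd : N * d = b - a := by rw [hd]; field_simp
  have key : ∀ i : ℕ, i ≤ N → F (a + i * d) - F a ≤ c * (i * d) := by
    intro i
    induction i with
    | zero => simp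
    | succ i ih =>
      intro hi
      have h1 := ih (by omega)
      have hi' : ((i : ℝ) + 1) * d ≤ N * d := by gcongr; exact_mod_cast hi
      have h0 : 0 ≤ (i : ℝ) * d := by positivity
      have h2 := h (a + i * d) ⟨by linarith, by linarith⟩ (a + (i + 1) * d)
        ⟨by linarith, by linarith⟩ (by linarith) (by linarith)
      push_cast
      linarith
  have := key N le_rfl
  rw [hNd] at this
  simpa using this

lemma intervalIntegral_le_mul_of_ae_le {f : ℝ → ℝ} {a b c : ℝ} (hab : a ≤ b)
    (hf : IntervalIntegrable f volume a b) (h : ∀ᵐ r, r ∈ uIoc a b → f r ≤ c) :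
    ∫ r in a..b, f r ≤ c * (b - a) := by
  have h1 : ∫ r in a..b, f r ≤ ∫ _ in a..b, c := by
    rw [intervalIntegral.integral_of_le hab, intervalIntegral.integral_of_le hab]
    rw [uIoc_of_le hab] at h
    exact setIntegral_mono_on_ae hf.1 (integrable_const c) measurableSet_Ioc h
  rwa [intervalIntegral.integral_const, smul_eq_mul, mul_comm] at h1

lemma nonpos_of_forall_le_mul {a K : ℝ} (h : ∀ ε : ℝ, 0 < ε → a ≤ ε * K) : a ≤ 0 := by
  by_contra! ha
  have h1 := h (a / (2 * (|K| + 1))) (by positivity)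
  have h2 : a / (2 * (|K| + 1)) * K ≤ a / (2 * (|K| + 1)) * (|K| + 1) := by
    gcongr; linarith [le_abs_self K]
  have h3 : a / (2 * (|K| + 1)) * (|K| + 1) = a / 2 := by field_simp
  linarith

namespace ControlProblem

variable {n m : ℕ} {P : ControlProblem n m} {s : ℝ} {z : EuclideanSpace ℝ (Fin n)}
  {x : ℝ → EuclideanSpace ℝ (Fin n)} {u : ℝ → EuclideanSpace ℝ (Fin m)}

namespace IsAdmissible

lemma intervalIntegrable_velocity (h : P.IsAdmissible s z x u) {a b : ℝ} (ha : s ≤ a)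
    (hb : s ≤ b) : IntervalIntegrable (fun r => P.f r (x r) (u r)) volume a b := by
  have h1 : uIcc a b ⊆ Ici s := fun r hr => (le_inf ha hb).trans hr.1
  exact (h.velocity_locallyIntegrable.integrableOn_compact_subset h1
    isCompact_uIcc).intervalIntegrable

lemma state_sub (h : P.IsAdmissible s z x u) {a b : ℝ} (ha : s ≤ a) (hb : s ≤ b) :
    x b - x a = ∫ r in a..b, P.f r (x r) (u r) := by
  rw [h.state_eq a ha, h.state_eq b hb, ← intervalIntegral.integral_interval_sub_left
    (h.intervalIntegrable_velocity le_rfl hb) (h.intervalIntegrable_velocity le_rfl ha)]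
  abel

lemma continuousOn_state (h : P.IsAdmissible s z x u) {b : ℝ} (hb : s ≤ b) :
    ContinuousOn x (Icc s b) := by
  have h1 := intervalIntegral.continuousOn_primitive_interval (μ := volume) (a := s) (b := b)
    (f := fun r => P.f r (x r) (u r))
    (h.velocity_locallyIntegrable.integrableOn_compact_subset
      (by rw [uIcc_of_le hb]; exact Icc_subset_Ici_self) isCompact_uIcc)
  rw [uIcc_of_le hb] at h1
  exact (continuousOn_const.add h1).congr fun t ht => h.state_eq t ht.1

lemma ae_control_mem (h : P.IsAdmissible s z x u) : ∀ᵐ r, s ≤ r → u r ∈ P.Ω :=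
  (ae_restrict_iff' measurableSet_Ici).mp h.control_mem

end IsAdmissible

lemma intervalIntegrable_discountedCost
    (h : IntegrableOn (P.discountedCost x u) (Ioi s)) {a b : ℝ} (ha : s ≤ a) (hb : s ≤ b) :
    IntervalIntegrable (P.discountedCost x u) volume a b := by
  rw [intervalIntegrable_iff]
  exact h.mono_set fun r hr => (le_inf ha hb).trans_lt hr.1

lemma pathValue_sub (φ : ℝ → EuclideanSpace ℝ (Fin n) → ℝ)
    (h : IntegrableOn (P.discountedCost x u) (Ioi s)) {a b : ℝ} (ha : s ≤ a) (hb : s ≤ b) :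
    P.pathValue φ x u b - P.pathValue φ x u a =
      φ b (x b) - φ a (x a) + ∫ r in a..b, P.discountedCost x u r := by
  have h1 := intervalIntegral.integral_interval_add_Ioi (a := a) (b := b)
    (h.mono_set (Ioi_subset_Ioi ha)) (h.mono_set (Ioi_subset_Ioi hb))
  unfold pathValue
  linarith

lemma mem_uIoc_le_abs {a b r : ℝ} (h : r ∈ uIoc a b) : |r - a| ≤ |b - a| :=
  abs_sub_left_of_mem_uIcc (uIoc_subset_uIcc h)

/-- Short-time estimates along a process, uniform in the base time and in bounded co-states. -/
lemma exists_short_time_estimates (hP : P.Standing) (hs : 0 ≤ s) (hadm : P.IsAdmissible s z x u)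
    (hcost : IntegrableOn (P.discountedCost x u) (Ioi s)) {a b ε C : ℝ} (hsa : s ≤ a)
    (hab : a ≤ b) (hC : 0 ≤ C) (hε : 0 < ε) :
    ∃ η : ℝ, 0 < η ∧ ∀ t₀ ∈ Icc a b, ∀ t₁ ∈ Icc a b, |t₁ - t₀| < η →
      ∀ p : ℝ × EuclideanSpace ℝ (Fin n), ‖p.2‖ ≤ C →
        (∀ᵐ r, r ∈ uIoc t₀ t₁ → u r ∈ P.Ω ∧
          |P.preHamiltonian r (x r) p.2 (u r) - P.preHamiltonian t₀ (x t₀) p.2 (u r)| ≤ ε) ∧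
        IntervalIntegrable (fun r => p.1 + P.preHamiltonian r (x r) p.2 (u r)) volume t₀ t₁ ∧
        p.1 * (t₁ - t₀) + inner ℝ p.2 (x t₁ - x t₀) + ∫ r in t₀..t₁, P.discountedCost x u r =
          ∫ r in t₀..t₁, (p.1 + P.preHamiltonian r (x r) p.2 (u r)) ∧
        C * (|t₁ - t₀| ^ 2 + ‖x t₁ - x t₀‖ ^ 2) ≤ ε * |t₁ - t₀| := by
  have hsb : s ≤ b := hsa.trans hab
  have hmemI : ∀ t ∈ Icc a b, t ∈ Icc 0 b := fun t ht => ⟨by linarith [ht.1], ht.2⟩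
  obtain ⟨R, hR⟩ := isCompact_Icc.exists_bound_of_continuousOn (hadm.continuousOn_state hsb)
  have hR' : ∀ t ∈ Icc a b, ‖x t‖ ≤ R := fun t ht => hR t ⟨hsa.trans ht.1, ht.2⟩
  have hR0 : 0 ≤ R := (norm_nonneg _).trans (hR' a ⟨le_rfl, hab⟩)
  obtain ⟨K, hK, hgrowth⟩ := hP.exists_norm_velocity_le
  set B := K * (1 + R) with hB
  have hB0 : 0 ≤ B := by positivity
  have hlip : ∀ t ∈ Icc a b, ∀ t' ∈ Icc a b, ‖x t' - x t‖ ≤ B * |t' - t| := by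
    intro t ht t' ht'
    rw [hadm.state_sub (hsa.trans ht.1) (hsa.trans ht'.1)]
    refine intervalIntegral.norm_integral_le_of_norm_le_const_ae ?_
    filter_upwards [hadm.ae_control_mem] with r hr hrt
    have hrI : r ∈ Icc a b := (uIcc_subset_Icc ht ht') (uIoc_subset_uIcc hrt)
    have h0 : 0 ≤ r := by linarith [hrI.1]
    have h1 := hgrowth r h0 (x r) (u r) (hr (hsa.trans hrI.1))
    have h2 : ‖P.f r (x r) (u r)‖ ≤ _ := (norm_snd_le (P.velocity r (x r) (u r))).trans h1
    refine h2.trans ?_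
    rw [hB]
    gcongr
    exact hR' r hrI
  obtain ⟨η₁, hη₁, hmod⟩ := hP.exists_velocity_modulus b R (ε := ε / (C + 1)) (by positivity)
  -- The first two bounds keep time and state within the modulus `η₁`; the third turns the quadratic
  -- remainder into `ε * |t₁ - t₀|`.
  refine ⟨min η₁ (min (η₁ / (B + 1)) (ε / (C * (1 + B ^ 2) + 1))), by positivity,
    fun t₀ ht₀ t₁ ht₁ htt p hpC => ?_⟩
  have ht₀s := hsa.trans ht₀.1
  have ht₁s := hsa.trans ht₁.1
  have hs1 : |t₁ - t₀| < η₁ := htt.trans_le (min_le_left _ _)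
  have hs2 : |t₁ - t₀| * (B + 1) < η₁ := by
    rw [← lt_div_iff₀ (by positivity)]
    exact htt.trans_le ((min_le_right _ _).trans (min_le_left _ _))
  have hs3 : |t₁ - t₀| * (C * (1 + B ^ 2) + 1) ≤ ε := by
    rw [← le_div_iff₀ (by positivity)]
    exact htt.le.trans ((min_le_right _ _).trans (min_le_right _ _))
  have hfi := hadm.intervalIntegrable_velocity ht₀s ht₁s
  have hci := intervalIntegrable_discountedCost hcost ht₀s ht₁s
  have hfi' : IntervalIntegrable (fun r => inner ℝ p.2 (P.f r (x r) (u r))) volume t₀ t₁ := by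
    rw [intervalIntegrable_iff] at hfi ⊢
    exact hfi.const_inner p.2
  have hinner : inner ℝ p.2 (x t₁ - x t₀) = ∫ r in t₀..t₁, inner ℝ p.2 (P.f r (x r) (u r)) := by
    rw [hadm.state_sub ht₀s ht₁s]
    exact ((innerSL ℝ p.2).intervalIntegral_comp_comm hfi).symm
  refine ⟨?_, intervalIntegrable_const.add (hfi'.add hci), ?_, ?_⟩
  · filter_upwards [hadm.ae_control_mem] with r hr hrt
    have hrI : r ∈ Icc a b := (uIcc_subset_Icc ht₀ ht₁) (uIoc_subset_uIcc hrt)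
    have hrΩ := hr (hsa.trans hrI.1)
    refine ⟨hrΩ, ?_⟩
    have hrt' := mem_uIoc_le_abs hrt
    have h1 := hmod r (hmemI r hrI) t₀ (hmemI t₀ ht₀) (x r) (x t₀) (hR' r hrI) (hR' t₀ ht₀)
      (by linarith) (by
        have := hlip t₀ ht₀ r hrI
        have h2 : B * |r - t₀| ≤ B * |t₁ - t₀| := by gcongr
        linarith [abs_nonneg (t₁ - t₀)]) (u r) hrΩ
    have h2 := abs_preHamiltonian_sub_le (P := P) r t₀ (x r) (x t₀) p.2 (u r)
    have h3 := (norm_fst_le (P.velocity r (x r) (u r) - P.velocity t₀ (x t₀) (u r))).trans h1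
    have h4 := (norm_snd_le (P.velocity r (x r) (u r) - P.velocity t₀ (x t₀) (u r))).trans h1
    have h5 : ‖p.2‖ * ‖(P.velocity r (x r) (u r)).2 - (P.velocity t₀ (x t₀) (u r)).2‖ ≤
        C * (ε / (C + 1)) := mul_le_mul hpC h4 (norm_nonneg _) hC
    have h6 : C * (ε / (C + 1)) + ε / (C + 1) = ε := by field_simp
    have h7 : |(P.velocity r (x r) (u r)).1 - (P.velocity t₀ (x t₀) (u r)).1| ≤ ε / (C + 1) := h3
    linarith
  · have h2 : (∫ r in t₀..t₁, (p.1 + P.preHamiltonian r (x r) p.2 (u r))) =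
        p.1 * (t₁ - t₀) + ((∫ r in t₀..t₁, inner ℝ p.2 (P.f r (x r) (u r))) +
          ∫ r in t₀..t₁, P.discountedCost x u r) := by
      rw [← intervalIntegral.integral_add hfi' hci, mul_comm p.1, ← smul_eq_mul (t₁ - t₀),
        ← intervalIntegral.integral_const,
        ← intervalIntegral.integral_add intervalIntegrable_const (hfi'.add hci)]
      rfl
    rw [h2, ← hinner]
    ring
  · have h3 := hlip t₀ ht₀ t₁ ht₁
    have h4 : ‖x t₁ - x t₀‖ ^ 2 ≤ (B * |t₁ - t₀|) ^ 2 := by gcongr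
    have h5 : C * (|t₁ - t₀| ^ 2 + ‖x t₁ - x t₀‖ ^ 2) ≤
        C * (|t₁ - t₀| ^ 2 + (B * |t₁ - t₀|) ^ 2) := by gcongr
    have h6 : |t₁ - t₀| * (C * (1 + B ^ 2) + 1) * |t₁ - t₀| ≤ ε * |t₁ - t₀| := by gcongr
    have h7 : C * (|t₁ - t₀| ^ 2 + (B * |t₁ - t₀|) ^ 2) ≤
        |t₁ - t₀| * (C * (1 + B ^ 2) + 1) * |t₁ - t₀| := by
      linarith [sq_nonneg |t₁ - t₀|]
    linarith

/-! ### From Hamilton–Jacobi inequalities to monotonicity along every process -/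

/-- Along a process, an inf-convolution of `φ` plus the accumulated cost changes on short time
intervals, forward or backward, at most by the Hamiltonian expression of a proximal
subgradient. -/
lemma exists_infConvolution_along (hP : P.Standing) {φ : ℝ → EuclideanSpace ℝ (Fin n) → ℝ}
    (hφ : ContinuousOn (fun q : ℝ × EuclideanSpace ℝ (Fin n) => φ q.1 q.2) {q | 0 ≤ q.1})
    (hs : 0 ≤ s) (hadm : P.IsAdmissible s z x u)
    (hcost : IntegrableOn (P.discountedCost x u) (Ioi s)) {a b ε : ℝ} (hsa : s ≤ a) (hab : a ≤ b)
    (hε : 0 < ε) :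
    ∃ (V : ℝ → EuclideanSpace ℝ (Fin n) → ℝ) (η : ℝ), 0 < η ∧
      (∀ t ∈ Icc a b, |V t (x t) - φ t (x t)| ≤ ε) ∧
      ∀ t₀ ∈ Icc a b, ∃ τ y, ∃ p ∈ proximalSubgradient φ τ y, 0 ≤ τ ∧ |t₀ - τ| < ε ∧
        ∀ t₁ ∈ Icc a b, |t₁ - t₀| < η →
          (∀ᵐ r, r ∈ uIoc t₀ t₁ → u r ∈ P.Ω ∧
            |P.preHamiltonian r (x r) p.2 (u r) - P.preHamiltonian τ y p.2 (u r)| ≤ 2 * ε) ∧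
          IntervalIntegrable (fun r => p.1 + P.preHamiltonian r (x r) p.2 (u r)) volume t₀ t₁ ∧
          V t₁ (x t₁) - V t₀ (x t₀) + ∫ r in t₀..t₁, P.discountedCost x u r ≤
            (∫ r in t₀..t₁, (p.1 + P.preHamiltonian r (x r) p.2 (u r))) + ε * |t₁ - t₀| := by
  have hsb : s ≤ b := hsa.trans hab
  have hmemI : ∀ t ∈ Icc a b, t ∈ Icc 0 b := fun t ht => ⟨by linarith [ht.1], ht.2⟩
  obtain ⟨R, hR⟩ := isCompact_Icc.exists_bound_of_continuousOn (hadm.continuousOn_state hsb)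
  have hR' : ∀ t ∈ Icc a b, ‖x t‖ ≤ R := fun t ht => hR t ⟨hsa.trans ht.1, ht.2⟩
  have hR0 : 0 ≤ R := (norm_nonneg _).trans (hR' a ⟨le_rfl, hab⟩)
  obtain ⟨V, C, hC, hV⟩ := hP.exists_infConvolution hφ (T := b) (R := R) (by linarith) hR0 hε
  obtain ⟨η, hη, hest⟩ := exists_short_time_estimates hP hs hadm hcost hsa hab hC hε
  refine ⟨V, η, hη, fun t ht => (hV t (hmemI t ht) (x t) (hR' t ht)).1, fun t₀ ht₀ => ?_⟩
  obtain ⟨-, τ, y, p, hp, hτ, htτ, hpC, hpre, hstep⟩ := hV t₀ (hmemI t₀ ht₀) (x t₀) (hR' t₀ ht₀)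
  refine ⟨τ, y, p, hp, hτ, htτ, fun t₁ ht₁ htt => ?_⟩
  obtain ⟨hae, hint, heq, hsq⟩ := hest t₀ ht₀ t₁ ht₁ htt p hpC
  refine ⟨?_, hint, ?_⟩
  · filter_upwards [hae] with r hr hrt
    obtain ⟨hrΩ, hr⟩ := hr hrt
    refine ⟨hrΩ, ?_⟩
    have h8 := abs_sub_le (P.preHamiltonian r (x r) p.2 (u r))
      (P.preHamiltonian t₀ (x t₀) p.2 (u r)) (P.preHamiltonian τ y p.2 (u r))
    linarith [hpre (u r) hrΩ]
  · linarith [hstep t₁ (x t₁)]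

theorem nonincreasingAlongEvery_of_supMaxHJB_le (hP : P.Standing)
    {φ : ℝ → EuclideanSpace ℝ (Fin n) → ℝ}
    (hφ : ContinuousOn (fun q : ℝ × EuclideanSpace ℝ (Fin n) => φ q.1 q.2) {q | 0 ≤ q.1})
    (h : ∀ s : ℝ, 0 ≤ s → ∀ z : EuclideanSpace ℝ (Fin n), P.supMaxHJB φ s z ≤ 0) :
    P.NonincreasingAlongEvery φ := by
  rintro s hs z ⟨x, u⟩ ⟨hadm, hcost⟩ a ha b hb hab
  simp only [mem_Ici] at ha hb hadm hcost ⊢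
  have hineq : ∀ τ y, 0 ≤ τ → ∀ p ∈ proximalSubgradient φ τ y, ∀ v ∈ P.Ω,
      p.1 + P.preHamiltonian τ y p.2 v ≤ 0 := by
    intro τ y hτ p hp v hv
    have h1 := (iSup₂_le_iff.mp (h τ hτ y)) p hp
    rw [← EReal.coe_zero, EReal.coe_le_coe_iff] at h1
    linarith [hP.le_maxHamiltonian hτ y p.2 hv]
  -- The rate `3 * ε` consists of `2 * ε` from the Hamiltonian and `ε` from the quadratic remainder;
  -- the additional `2 * ε` pays for exchanging `V` and `φ` at the two ends.
  refine sub_nonpos.mp (nonpos_of_forall_le_mul (K := 3 * (b - a) + 2) fun ε hε => ?_)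
  obtain ⟨V, η, hη, hV, hstep⟩ := exists_infConvolution_along hP hφ hs hadm hcost ha hab hε
  have hchain := sub_le_mul_of_forall_short (c := 3 * ε)
    (F := fun t => V t (x t) + ∫ r in a..t, P.discountedCost x u r) hab hη (by
      intro t ht t' ht' htt hlt
      obtain ⟨τ, y, p, hp, hτ, -, hp'⟩ := hstep t ht
      obtain ⟨hae, hint, hle⟩ := hp' t' ht' (by rwa [abs_of_nonneg (by linarith)])
      have h1 := intervalIntegral_le_mul_of_ae_le (c := 2 * ε) htt hint (by
        filter_upwards [hae] with r hr hrt
        obtain ⟨hrΩ, hr⟩ := hr hrt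
        linarith [hineq τ y hτ p hp (u r) hrΩ, abs_le.mp hr])
      have h2 := intervalIntegral.integral_interval_sub_left
        (intervalIntegrable_discountedCost hcost ha (ha.trans ht'.1))
        (intervalIntegrable_discountedCost hcost ha (ha.trans ht.1))
      rw [abs_of_nonneg (by linarith)] at hle
      linarith)
  rw [pathValue_sub φ hcost ha hb]
  simp only [intervalIntegral.integral_same] at hchain
  have h1 := abs_le.mp (hV a ⟨le_rfl, hab⟩)
  have h2 := abs_le.mp (hV b ⟨hab, le_rfl⟩)
  linarith

lemma continuousOn_pathValue {φ : ℝ → EuclideanSpace ℝ (Fin n) → ℝ}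
    (hφ : ContinuousOn (fun q : ℝ × EuclideanSpace ℝ (Fin n) => φ q.1 q.2) {q | 0 ≤ q.1})
    (hs : 0 ≤ s) (hadm : P.IsAdmissible s z x u)
    (hcost : IntegrableOn (P.discountedCost x u) (Ioi s)) {b : ℝ} (hb : s ≤ b) :
    ContinuousOn (P.pathValue φ x u) (Icc s b) := by
  have h1 : ContinuousOn (fun t => φ t (x t)) (Icc s b) :=
    hφ.comp (continuousOn_id.prodMk (hadm.continuousOn_state hb)) fun t ht => hs.trans ht.1
  have h2 := intervalIntegral.continuousOn_primitive_interval (μ := volume) (a := s) (b := b)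
    (f := P.discountedCost x u)
    (by
      rw [uIcc_of_le hb, integrableOn_Icc_iff_integrableOn_Ioc]
      exact hcost.mono_set Ioc_subset_Ioi_self)
  rw [uIcc_of_le hb] at h2
  refine ((h1.add h2).add (continuousOn_const (c := P.pathValue φ x u s - φ s (x s)))).congr
    fun t ht => ?_
  have := pathValue_sub φ hcost le_rfl ht.1
  simp only [Pi.add_apply]
  linarith

theorem nondecreasingAlongEvery_of_le_infHJB (hP : P.Standing)
    {φ : ℝ → EuclideanSpace ℝ (Fin n) → ℝ}
    (hφ : ContinuousOn (fun q : ℝ × EuclideanSpace ℝ (Fin n) => φ q.1 q.2) {q | 0 ≤ q.1})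
    (h : ∀ s : ℝ, 0 < s → ∀ z : EuclideanSpace ℝ (Fin n), 0 ≤ P.infHJB φ s z) :
    P.NondecreasingAlongEvery φ := by
  rintro s hs z ⟨x, u⟩ ⟨hadm, hcost⟩
  simp only at hadm hcost ⊢
  have hineq : ∀ τ y, 0 < τ → ∀ p ∈ proximalSubgradient φ τ y, ∀ v ∈ P.Ω,
      0 ≤ p.1 + P.preHamiltonian τ y p.2 v := by
    intro τ y hτ p hp v hv
    have h1 := (le_iInf₂_iff.mp (h τ hτ y)) p hp
    rw [← EReal.coe_zero, EReal.coe_le_coe_iff] at h1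
    linarith [hP.hamiltonian_le hτ.le y p.2 hv]
  have hopen : ∀ a b : ℝ, s < a → a ≤ b → P.pathValue φ x u a ≤ P.pathValue φ x u b := by
    intro a b ha hab
    have ha0 : 0 < a := by linarith
    have hb : s ≤ b := by linarith
    -- With `ε < a`, the minimiser's time lies within `ε` of a time at least `a` and is thus
    -- positive, where the hypothesis applies.
    have key : ∀ ε : ℝ, 0 < ε → ε < a →
        P.pathValue φ x u a - P.pathValue φ x u b ≤ ε * (3 * (b - a) + 2) := by
      intro ε hε hεa
      obtain ⟨V, η, hη, hV, hstep⟩ := exists_infConvolution_along hP hφ hs hadm hcost ha.le hab hε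
      have hchain := sub_le_mul_of_forall_short (c := 3 * ε)
        (F := fun t => -(V t (x t) + ∫ r in a..t, P.discountedCost x u r)) hab hη (by
          intro t ht t' ht' htt hlt
          -- The base point is the right end `t'` and the step runs backward to `t`, so a lower
          -- bound on the Hamiltonian becomes an upper bound on the reversed integral.
          obtain ⟨τ, y, p, hp, hτ, htτ, hp'⟩ := hstep t' ht'
          have hτ0 : 0 < τ := by linarith [abs_lt.mp htτ, ht'.1]
          obtain ⟨hae, hint, hle⟩ := hp' t ht (by rwa [abs_sub_comm, abs_of_nonneg (by linarith)])
          have h1 := intervalIntegral_le_mul_of_ae_le (c := 2 * ε) htt hint.symm.neg (by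
            filter_upwards [hae] with r hr hrt
            obtain ⟨hrΩ, hr⟩ := hr (by rwa [uIoc_comm])
            simp only [Pi.neg_apply]
            linarith [hineq τ y hτ0 p hp (u r) hrΩ, abs_le.mp hr])
          have h2 := intervalIntegral.integral_interval_sub_left
            (intervalIntegrable_discountedCost hcost ha.le (ha.le.trans ht.1))
            (intervalIntegrable_discountedCost hcost ha.le (ha.le.trans ht'.1))
          simp only [Pi.neg_apply, intervalIntegral.integral_neg] at h1
          rw [← intervalIntegral.integral_symm] at h1
          rw [abs_sub_comm, abs_of_nonneg (by linarith)] at hle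
          linarith)
      have h0 := pathValue_sub φ hcost ha.le hb
      simp only [intervalIntegral.integral_same] at hchain
      have h1 := abs_le.mp (hV a ⟨le_rfl, hab⟩)
      have h2 := abs_le.mp (hV b ⟨hab, le_rfl⟩)
      linarith
    have hlim : Tendsto (fun ε : ℝ => ε * (3 * (b - a) + 2)) (𝓝[>] 0) (𝓝 0) := by
      refine tendsto_nhdsWithin_of_tendsto_nhds (Continuous.tendsto' (by fun_prop) _ _ (by simp))
    refine sub_nonpos.mp (ge_of_tendsto hlim ?_)
    filter_upwards [Ioo_mem_nhdsGT ha0] with ε hε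
    exact key ε hε.1 hε.2
  intro a ha b hb hab
  simp only [mem_Ici] at ha hb
  rcases ha.lt_or_eq with ha | rfl
  · exact hopen a b ha hab
  rcases hab.eq_or_lt with rfl | hab
  · rfl
  have hc : Tendsto (P.pathValue φ x u) (𝓝[>] s) (𝓝 (P.pathValue φ x u s)) := by
    have := (continuousOn_pathValue hφ hs hadm hcost hb) s ⟨le_rfl, hb⟩
    rw [ContinuousWithinAt, nhdsWithin_Icc_eq_nhdsGE hab] at this
    exact this.mono_left (nhdsWithin_mono _ Ioi_subset_Ici_self)
  refine le_of_tendsto hc ?_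
  filter_upwards [Ioo_mem_nhdsGT hab] with a ha
  exact hopen a b ha.1 ha.2.le

end ControlProblem

/-! ### Processes with an initially constant control -/

lemma locallyIntegrableOn_Ici_ite {F : Type*} [NormedAddCommGroup F] {g₁ g₂ : ℝ → F} {a b : ℝ}
    (h₁ : IntegrableOn g₁ (Icc a b)) (h₂ : LocallyIntegrableOn g₂ (Ici b)) :
    LocallyIntegrableOn (fun t => if t ≤ b then g₁ t else g₂ t) (Ici a) := by
  rw [locallyIntegrableOn_iff isClosed_Ici.isLocallyClosed]
  intro K hKa hK
  have hsub : K ⊆ Icc a b ∪ (K ∩ Ici b) ∩ Ioi b := by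
    intro t ht
    rcases le_or_gt t b with h | h
    · exact Or.inl ⟨hKa ht, h⟩
    · exact Or.inr ⟨⟨ht, h.le⟩, h⟩
  refine IntegrableOn.mono_set (IntegrableOn.union ?_ ?_) hsub
  · exact h₁.congr_fun (fun t ht => by simp [ht.2]) measurableSet_Icc
  · have := h₂.integrableOn_compact_subset inter_subset_right (hK.inter_right isClosed_Ici)
    refine (this.mono_set inter_subset_left).congr_fun (fun t ht => ?_)
      ((hK.measurableSet.inter measurableSet_Ici).inter measurableSet_Ioi)
    simp [not_le.mpr (show b < t from ht.2)]

namespace ControlProblem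

variable {n m : ℕ} {P : ControlProblem n m} {s : ℝ} {z : EuclideanSpace ℝ (Fin n)}
  {x : ℝ → EuclideanSpace ℝ (Fin n)} {u : ℝ → EuclideanSpace ℝ (Fin m)}

/-- Local solvability of the state equation with a constant control, in both time directions. -/
lemma exists_local_solution (hP : P.Standing) (s : ℝ) (z : EuclideanSpace ℝ (Fin n))
    {v : EuclideanSpace ℝ (Fin m)} (hv : v ∈ P.Ω) {ε₀ : ℝ} (hε₀ : 0 < ε₀) :
    ∃ ε : ℝ, 0 < ε ∧ ε ≤ ε₀ ∧ ∃ x : ℝ → EuclideanSpace ℝ (Fin n), x s = z ∧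
      ∀ t ∈ Icc (s - ε) (s + ε),
        HasDerivWithinAt x (P.f (max t 0) (x t) v) (Icc (s - ε) (s + ε)) t := by
  obtain ⟨K₁, hK₁, hLip⟩ := hP.lipschitz
  obtain ⟨K, hK, hgrowth⟩ := hP.exists_norm_velocity_le
  set L : ℝ := K * (2 + ‖z‖) with hL
  have hL0 : 0 < L := by positivity
  set ε := min ε₀ (1 / L) with hε
  have hεpos : 0 < ε := by positivity
  have ht₀ : s ∈ Icc (s - ε) (s + ε) := ⟨by linarith, by linarith⟩
  -- The truncation `max t 0` makes the field continuous across time zero. `L` bounds the speed on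
  -- the unit ball around `z`, which a solution cannot leave within time `1 / L`.
  have hpl : IsPicardLindelof (fun t y => P.f (max t 0) y v) (⟨s, ht₀⟩ : Icc (s - ε) (s + ε))
      z 1 0 L.toNNReal K₁.toNNReal := by
    refine ⟨fun t _ => LipschitzWith.lipschitzOnWith (LipschitzWith.of_dist_le_mul fun y y' => ?_),
      fun y _ => ?_, fun t _ y hy => ?_, ?_⟩
    · rw [dist_eq_norm, dist_eq_norm]
      have := hLip (max t 0) (le_max_right _ _) v hv y y'
      rw [Real.coe_toNNReal _ hK₁.le]
      linarith [abs_nonneg (P.l (max t 0) y v - P.l (max t 0) y' v)]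
    · exact hP.continuous_f.comp (f := fun t : ℝ => (max t 0, y, v))
        (Continuous.continuousOn (by fun_prop)) fun t _ => le_max_right t 0
    · have h1 := (norm_snd_le (P.velocity (max t 0) y v)).trans
        (hgrowth (max t 0) (le_max_right _ _) y v hv)
      have h2 : ‖y‖ ≤ 1 + ‖z‖ := by
        have := norm_sub_norm_le y z
        rw [mem_closedBall_iff_norm] at hy
        simp only [NNReal.coe_one] at hy
        linarith
      refine h1.trans ?_
      rw [Real.coe_toNNReal _ hL0.le, hL]
      refine mul_le_mul_of_nonneg_left ?_ hK.le
      linarith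
    · simp only [Real.coe_toNNReal _ hL0.le, NNReal.coe_one, NNReal.coe_zero, add_sub_cancel_left,
        sub_sub_cancel, max_self, sub_zero]
      have : ε ≤ 1 / L := min_le_right _ _
      rw [le_div_iff₀ hL0] at this
      linarith
  obtain ⟨x, hx, hx'⟩ := hpl.exists_eq_forall_mem_Icc_hasDerivWithinAt₀
  exact ⟨ε, hεpos, min_le_left _ _, x, hx, hx'⟩

/-- Following a solution with constant control on `[a, b]` by a finite cost process from its end
point gives a finite cost process. -/
lemma exists_concat_mem_finiteCostProcesses (hP : P.Standing) {a b : ℝ} (ha : 0 ≤ a) (hab : a ≤ b)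
    {x₁ : ℝ → EuclideanSpace ℝ (Fin n)} {v : EuclideanSpace ℝ (Fin m)} (hv : v ∈ P.Ω)
    (hx₁ : ∀ t ∈ Icc a b, HasDerivWithinAt x₁ (P.f t (x₁ t) v) (Icc a b) t)
    (hne : (P.finiteCostProcesses b (x₁ b)).Nonempty) :
    ∃ p ∈ P.finiteCostProcesses a (x₁ a), ∀ t ∈ Icc a b, p.1 t = x₁ t ∧ p.2 t = v := by
  obtain ⟨⟨x₂, u₂⟩, hadm, hcost⟩ := hne
  simp only at hadm hcost
  have hx₁c : ContinuousOn x₁ (Icc a b) := fun t ht => (hx₁ t ht).continuousWithinAt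
  have hvelc : ContinuousOn (fun t => P.velocity t (x₁ t) v) (Icc a b) :=
    hP.continuousOn_velocity.comp (f := fun t => (t, x₁ t, v))
      (continuousOn_id.prodMk (hx₁c.prodMk continuousOn_const)) fun t ht => ha.trans ht.1
  have hfc : ContinuousOn (fun t => P.f t (x₁ t) v) (Icc a b) := hvelc.snd
  have hlc : ContinuousOn (fun t => (P.velocity t (x₁ t) v).1) (Icc a b) := hvelc.fst
  set x : ℝ → EuclideanSpace ℝ (Fin n) := fun t => if t ≤ b then x₁ t else x₂ t with hx
  set u : ℝ → EuclideanSpace ℝ (Fin m) := fun t => if t ≤ b then v else u₂ t with hu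
  have hxu : ∀ t, t ≤ b → x t = x₁ t ∧ u t = v := fun t ht => by simp [hx, hu, ht]
  have hxu' : ∀ t, b < t → x t = x₂ t ∧ u t = u₂ t := fun t ht => by
    simp [hx, hu, not_le.mpr ht]
  have hF : (fun r => P.f r (x r) (u r)) =
      fun r => if r ≤ b then P.f r (x₁ r) v else P.f r (x₂ r) (u₂ r) := by
    funext r
    rcases le_or_gt r b with h | h
    · rw [(hxu r h).1, (hxu r h).2, if_pos h]
    · rw [(hxu' r h).1, (hxu' r h).2, if_neg (not_le.mpr h)]
  have hFint : LocallyIntegrableOn (fun r => P.f r (x r) (u r)) (Ici a) := by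
    rw [hF]
    exact locallyIntegrableOn_Ici_ite (hfc.integrableOn_compact isCompact_Icc)
      hadm.velocity_locallyIntegrable
  have hFi : ∀ c d, a ≤ c → c ≤ d →
      IntervalIntegrable (fun r => P.f r (x r) (u r)) volume c d := fun c d hc hcd => by
    refine (hFint.integrableOn_compact_subset (?_ : uIcc c d ⊆ _) isCompact_uIcc).intervalIntegrable
    rw [uIcc_of_le hcd]
    exact fun r hr => hc.trans hr.1
  have hstate₁ : ∀ t ∈ Icc a b, x t = x₁ a + ∫ r in a..t, P.f r (x r) (u r) := by
    intro t ht
    have h1 : ∫ r in a..t, P.f r (x r) (u r) = ∫ r in a..t, P.f r (x₁ r) v := by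
      refine intervalIntegral.integral_congr fun r hr => ?_
      rw [uIcc_of_le ht.1] at hr
      simp only [(hxu r (hr.2.trans ht.2)).1, (hxu r (hr.2.trans ht.2)).2]
    have h2 : ∫ r in a..t, P.f r (x₁ r) v = x₁ t - x₁ a := by
      have hsub : Icc a t ⊆ Icc a b := Icc_subset_Icc_right ht.2
      refine intervalIntegral.integral_eq_sub_of_hasDerivAt_of_le ht.1 (hx₁c.mono hsub)
        (fun r hr => ?_) ?_
      · exact (hx₁ r ⟨hr.1.le, hr.2.le.trans ht.2⟩).hasDerivAt
          (Icc_mem_nhds hr.1 (hr.2.trans_le ht.2))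
      · exact (hfc.mono hsub).intervalIntegrable_of_Icc ht.1
    rw [(hxu t ht.2).1, h1, h2]
    abel
  have hadm' : P.IsAdmissible a (x₁ a) x u := by
    refine ⟨locallyIntegrableOn_Ici_ite (integrableOn_const (by simp))
      hadm.control_locallyIntegrable, ?_, hFint, fun t ht => ?_⟩
    · rw [ae_restrict_iff' measurableSet_Ici]
      filter_upwards [hadm.ae_control_mem] with t ht hta
      rcases le_or_gt t b with h | h
      · rw [(hxu t h).2]; exact hv
      · rw [(hxu' t h).2]; exact ht h.le
    · rcases le_or_gt t b with h | h
      · exact hstate₁ t ⟨ht, h⟩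
      · rw [(hxu' t h).1, hadm.state_eq t h.le,
          ← intervalIntegral.integral_add_adjacent_intervals (hFi a b le_rfl hab) (hFi b t hab h.le),
          ← add_assoc, ← hstate₁ b ⟨hab, le_rfl⟩, (hxu b le_rfl).1]
        congr 1
        refine intervalIntegral.integral_congr_ae (Eventually.of_forall fun r hr => ?_)
        rw [uIoc_of_le h.le] at hr
        rw [(hxu' r hr.1).1, (hxu' r hr.1).2]
  refine ⟨(x, u), ⟨hadm', ?_⟩, fun t ht => hxu t ht.2⟩
  simp only
  rw [← Ioc_union_Ioi_eq_Ioi hab]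
  refine IntegrableOn.union ?_ ?_
  · refine ((hlc.integrableOn_compact isCompact_Icc).mono_set Ioc_subset_Icc_self).congr_fun
      (fun r hr => ?_) measurableSet_Ioc
    simp only [discountedCost, velocity, (hxu r hr.2).1, (hxu r hr.2).2]
  · refine hcost.congr_fun (fun r hr => ?_) measurableSet_Ioi
    simp only [discountedCost, (hxu' r hr).1, (hxu' r hr).2]

/-! ### From monotonicity to Hamilton–Jacobi inequalities -/

/-- If the path value along a process does not exceed its value at `t₀` for times `t₁` of an
interval adjacent to `t₀`, then the Hamiltonian expression of a proximal subgradient at `t₀` has a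
non-positive mean in the limit `t₁ → t₀`. -/
lemma eventually_integral_le_of_pathValue_le (hP : P.Standing)
    {φ : ℝ → EuclideanSpace ℝ (Fin n) → ℝ} (hs : 0 ≤ s) (hadm : P.IsAdmissible s z x u)
    (hcost : IntegrableOn (P.discountedCost x u) (Ioi s)) {b t₀ ε : ℝ}
    (ht₀ : t₀ ∈ Icc s b) (hε : 0 < ε) {p : ℝ × EuclideanSpace ℝ (Fin n)}
    (hp : p ∈ proximalSubgradient φ t₀ (x t₀)) :
    ∀ᶠ t₁ in 𝓝[Icc s b] t₀, P.pathValue φ x u t₁ ≤ P.pathValue φ x u t₀ →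
      (∀ᵐ r, r ∈ uIoc t₀ t₁ → u r ∈ P.Ω ∧
        |P.preHamiltonian r (x r) p.2 (u r) - P.preHamiltonian t₀ (x t₀) p.2 (u r)| ≤ ε) ∧
      IntervalIntegrable (fun r => p.1 + P.preHamiltonian r (x r) p.2 (u r)) volume t₀ t₁ ∧
      ∫ r in t₀..t₁, (p.1 + P.preHamiltonian r (x r) p.2 (u r)) ≤ ε * |t₁ - t₀| := by
  have hsb : s ≤ b := ht₀.1.trans ht₀.2
  obtain ⟨σ, hσ, hprox⟩ := hp
  -- This constant dominates both the co-state norm and the proximal coefficient `σ`.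
  obtain ⟨η, hη, hest⟩ := exists_short_time_estimates hP hs hadm hcost (ε := ε)
    (C := ‖p.2‖ + σ) le_rfl hsb (by positivity) hε
  have hxc : Tendsto (fun t => (t, x t)) (𝓝[Icc s b] t₀) (𝓝[{q | 0 ≤ q.1}] (t₀, x t₀)) := by
    refine tendsto_nhdsWithin_of_tendsto_nhds_of_eventually_within _ ?_ ?_
    · exact ContinuousWithinAt.tendsto (f := fun t => (t, x t))
        (continuousWithinAt_id.prodMk (hadm.continuousOn_state hsb t₀ ht₀))
    · filter_upwards [self_mem_nhdsWithin] with t ht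
      exact hs.trans ht.1
  have hclose : ∀ᶠ t₁ in 𝓝[Icc s b] t₀, |t₁ - t₀| < η := by
    have := Metric.ball_mem_nhds t₀ hη
    filter_upwards [nhdsWithin_le_nhds this] with t ht
    rwa [Metric.mem_ball, Real.dist_eq] at ht
  filter_upwards [hxc.eventually hprox, hclose, self_mem_nhdsWithin] with t₁ h1 h2 h3 hle
  obtain ⟨hae, hint, heq, hsq⟩ := hest t₀ ht₀ t₁ h3 h2 p (by linarith)
  refine ⟨hae, hint, ?_⟩
  have h4 := pathValue_sub φ hcost ht₀.1 h3.1
  have h5 : 0 ≤ ‖p.2‖ * (|t₁ - t₀| ^ 2 + ‖x t₁ - x t₀‖ ^ 2) := by positivity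
  rw [← heq]
  linarith

lemma add_le_of_pathValue_le_forward (hP : P.Standing)
    {φ : ℝ → EuclideanSpace ℝ (Fin n) → ℝ} (hs : 0 ≤ s) (hadm : P.IsAdmissible s z x u)
    (hcost : IntegrableOn (P.discountedCost x u) (Ioi s)) {b c : ℝ} (hb : s < b)
    {p : ℝ × EuclideanSpace ℝ (Fin n)} (hp : p ∈ proximalSubgradient φ s (x s))
    (hle : ∀ t ∈ Icc s b, P.pathValue φ x u t ≤ P.pathValue φ x u s)
    (hc : ∀ r ∈ Ioc s b, u r ∈ P.Ω → c ≤ P.preHamiltonian s (x s) p.2 (u r)) :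
    p.1 + c ≤ 0 := by
  refine nonpos_of_forall_le_mul (K := 2) fun ε hε => ?_
  have hev := eventually_integral_le_of_pathValue_le (φ := φ) hP hs hadm hcost
    (left_mem_Icc.mpr hb.le) hε hp
  rw [nhdsWithin_Icc_eq_nhdsGE hb] at hev
  obtain ⟨t, h1, hst, htb⟩ := ((hev.filter_mono (nhdsWithin_mono _ Ioi_subset_Ici_self)).and
    (Ioo_mem_nhdsGT hb)).exists
  obtain ⟨hae, hint, hle'⟩ := h1 (hle t ⟨hst.le, htb.le⟩)
  -- The integrand is at least `p.1 + c - ε`, while its integral is at most `ε * (t - s)`. Dividing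
  -- by `t - s` leaves `p.1 + c ≤ 2 * ε`.
  have h2 := intervalIntegral_le_mul_of_ae_le (c := -(p.1 + c - ε)) hst.le hint.neg (by
    filter_upwards [hae] with r hr hrt
    obtain ⟨hrΩ, hr⟩ := hr hrt
    rw [uIoc_of_le hst.le] at hrt
    have := hc r ⟨hrt.1, hrt.2.trans htb.le⟩ hrΩ
    simp only [Pi.neg_apply]
    linarith [abs_le.mp hr])
  simp only [Pi.neg_apply, intervalIntegral.integral_neg] at h2
  rw [abs_of_pos (sub_pos.mpr hst)] at hle'
  have h3 : (p.1 + c - ε) * (t - s) ≤ ε * (t - s) := by linarith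
  have := le_of_mul_le_mul_right h3 (sub_pos.mpr hst)
  linarith

lemma nonneg_add_of_pathValue_le_backward (hP : P.Standing)
    {φ : ℝ → EuclideanSpace ℝ (Fin n) → ℝ} (hs : 0 ≤ s) (hadm : P.IsAdmissible s z x u)
    (hcost : IntegrableOn (P.discountedCost x u) (Ioi s)) {b c : ℝ} (hb : s < b)
    {p : ℝ × EuclideanSpace ℝ (Fin n)} (hp : p ∈ proximalSubgradient φ b (x b))
    (hle : ∀ t ∈ Icc s b, P.pathValue φ x u t ≤ P.pathValue φ x u b)
    (hc : ∀ r ∈ Ioc s b, u r ∈ P.Ω → P.preHamiltonian b (x b) p.2 (u r) ≤ c) :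
    0 ≤ p.1 + c := by
  refine neg_nonpos.mp (nonpos_of_forall_le_mul (K := 2) fun ε hε => ?_)
  have hev := eventually_integral_le_of_pathValue_le (φ := φ) hP hs hadm hcost
    (right_mem_Icc.mpr hb.le) hε hp
  rw [nhdsWithin_Icc_eq_nhdsLE hb] at hev
  obtain ⟨t, h1, hst, htb⟩ := ((hev.filter_mono (nhdsWithin_mono _ Iio_subset_Iic_self)).and
    (Ioo_mem_nhdsLT hb)).exists
  obtain ⟨hae, hint, hle'⟩ := h1 (hle t ⟨hst.le, htb.le⟩)
  have h2 := intervalIntegral_le_mul_of_ae_le (c := p.1 + c + ε) htb.le hint.symm (by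
    filter_upwards [hae] with r hr hrt
    rw [uIoc_comm] at hr
    obtain ⟨hrΩ, hr⟩ := hr hrt
    rw [uIoc_of_le htb.le] at hrt
    have := hc r ⟨hst.trans hrt.1, hrt.2⟩ hrΩ
    linarith [abs_le.mp hr])
  rw [intervalIntegral.integral_symm, abs_sub_comm, abs_of_pos (sub_pos.mpr htb)] at hle'
  have h3 : -(p.1 + c + ε) * (b - t) ≤ ε * (b - t) := by linarith
  have := le_of_mul_le_mul_right h3 (sub_pos.mpr htb)
  linarith

theorem supHJB_le_of_nonincreasingAlongSome (hP : P.Standing)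
    {φ : ℝ → EuclideanSpace ℝ (Fin n) → ℝ} (h : P.NonincreasingAlongSome φ) (hs : 0 ≤ s)
    (z : EuclideanSpace ℝ (Fin n)) : P.supHJB φ s z ≤ 0 := by
  refine iSup₂_le fun p hp => ?_
  rw [← EReal.coe_zero, EReal.coe_le_coe_iff]
  obtain ⟨⟨x, u⟩, ⟨hadm, hcost⟩, hanti⟩ := h s hs z
  simp only at hadm hcost hanti
  have hx : x s = z := by simpa using hadm.state_eq s le_rfl
  refine add_le_of_pathValue_le_forward hP hs hadm hcost (lt_add_one s) (hx ▸ hp)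
    (fun t ht => hanti self_mem_Ici ht.1 ht.1) fun r _ hr => ?_
  rw [hx]
  exact hP.hamiltonian_le hs z p.2 hr

theorem supMaxHJB_le_of_nonincreasingAlongEvery (hP : P.Standing)
    {φ : ℝ → EuclideanSpace ℝ (Fin n) → ℝ}
    (hne : ∀ τ : ℝ, 0 ≤ τ → ∀ z, (P.finiteCostProcesses τ z).Nonempty)
    (h : P.NonincreasingAlongEvery φ) (hs : 0 ≤ s)
    (z : EuclideanSpace ℝ (Fin n)) : P.supMaxHJB φ s z ≤ 0 := by
  refine iSup₂_le fun p hp => ?_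
  rw [← EReal.coe_zero, EReal.coe_le_coe_iff, ← le_neg_iff_add_nonpos_left]
  refine hP.maxHamiltonian_le fun v hv => ?_
  rw [le_neg_iff_add_nonpos_left]
  obtain ⟨ε, hε, -, y, hy, hy'⟩ := exists_local_solution hP s z hv one_pos
  have hsub : Icc s (s + ε) ⊆ Icc (s - ε) (s + ε) := Icc_subset_Icc_left (by linarith)
  obtain ⟨⟨x, u⟩, hxu, hxu'⟩ := exists_concat_mem_finiteCostProcesses hP hs
    (show s ≤ s + ε by linarith) hv
    (fun t ht => by
      have := (hy' t (hsub ht)).mono hsub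
      rwa [max_eq_left (hs.trans ht.1)] at this) (hne _ (by linarith) _)
  have hanti := h s hs (y s) (x, u) hxu
  obtain ⟨hadm, hcost⟩ := hxu
  simp only at hadm hcost hanti hxu'
  have hx : x s = z := by rw [(hxu' s ⟨le_rfl, by linarith⟩).1, hy]
  refine add_le_of_pathValue_le_forward hP hs hadm hcost (show s < s + ε by linarith) (hx ▸ hp)
    (fun t ht => hanti self_mem_Ici ht.1 ht.1) fun r hr _ => ?_
  rw [hx, (hxu' r ⟨hr.1.le, hr.2⟩).2]

/-- The constant control minimising the Hamiltonian at `(s, z)` is run backward from `z`. The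
resulting arc, started at a time `s - ε ≥ 0`, reaches `z` at time `s` and is continued by a finite
cost process. Monotonicity up to the arrival time bounds the minimum from below. -/
theorem le_infHJB_of_nondecreasingAlongEvery (hP : P.Standing)
    {φ : ℝ → EuclideanSpace ℝ (Fin n) → ℝ}
    (hne : ∀ τ : ℝ, 0 ≤ τ → ∀ z, (P.finiteCostProcesses τ z).Nonempty)
    (h : P.NondecreasingAlongEvery φ) (hs : 0 < s)
    (z : EuclideanSpace ℝ (Fin n)) : 0 ≤ P.infHJB φ s z := by
  refine le_iInf₂ fun p hp => ?_
  rw [← EReal.coe_zero, EReal.coe_le_coe_iff]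
  obtain ⟨v, hv, hvH⟩ := hP.exists_preHamiltonian_eq_hamiltonian hs.le z p.2
  obtain ⟨ε, hε, hεs, y, hy, hy'⟩ := exists_local_solution hP s z hv hs
  have hsub : Icc (s - ε) s ⊆ Icc (s - ε) (s + ε) := Icc_subset_Icc_right (by linarith)
  have hsε : 0 ≤ s - ε := by linarith
  have hlt : s - ε < s := by linarith
  obtain ⟨⟨x, u⟩, hxu, hxu'⟩ := exists_concat_mem_finiteCostProcesses hP hsε hlt.le hv
    (fun t ht => by
      have := (hy' t (hsub ht)).mono hsub
      rwa [max_eq_left (hsε.trans ht.1)] at this) (hne _ hs.le _)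
  have hmono := h (s - ε) hsε (y (s - ε)) (x, u) hxu
  obtain ⟨hadm, hcost⟩ := hxu
  simp only at hadm hcost hmono hxu'
  have hx : x s = z := by rw [(hxu' s ⟨hlt.le, le_rfl⟩).1, hy]
  refine nonneg_add_of_pathValue_le_backward hP hsε hadm hcost hlt (hx ▸ hp)
    (fun t ht => hmono ht.1 hlt.le ht.2) fun r hr _ => ?_
  rw [hx, (hxu' r ⟨hr.1.le, hr.2⟩).2, hvH]

end ControlProblem

/-! ### Measurable selection and integration of derivatives -/

lemma measurableSet_exists_mem_eq_zero {T Y : Type*} [MeasurableSpace T] [TopologicalSpace Y]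
    [SecondCountableTopology Y] {Q : Set Y} (hQ : IsCompact Q) {g : T → Y → ℝ}
    (hg0 : ∀ t c, 0 ≤ g t c) (hgc : ∀ t, Continuous (g t)) (hgm : ∀ c, Measurable fun t => g t c) :
    MeasurableSet {t | ∃ c ∈ Q, g t c = 0} := by
  obtain ⟨D, hDc, hDd⟩ := TopologicalSpace.exists_countable_dense Q
  -- By compactness a zero exists iff the infimum over `Q` vanishes, and by continuity a countable
  -- dense set detects this.
  have heq : {t | ∃ c ∈ Q, g t c = 0} =
      ⋂ k : ℕ, ⋃ d ∈ D, {t | g t d < 1 / ((k : ℝ) + 1)} := by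
    ext t
    simp only [mem_ofPred_eq, mem_iInter, mem_iUnion, exists_prop]
    constructor
    · rintro ⟨c, hc, hc0⟩ k
      have ho : IsOpen {d : Q | g t d < 1 / ((k : ℝ) + 1)} :=
        isOpen_lt ((hgc t).comp continuous_subtype_val) continuous_const
      obtain ⟨d, hd, hdD⟩ := hDd.inter_open_nonempty _ ho
        ⟨⟨c, hc⟩, by simp only [mem_ofPred_eq, hc0]; positivity⟩
      exact ⟨d, hdD, hd⟩
    · intro h
      have hne : Q.Nonempty := by
        obtain ⟨d, -, -⟩ := h 0
        exact ⟨d, d.2⟩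
      obtain ⟨c, hc, hmin⟩ := hQ.exists_isMinOn hne (hgc t).continuousOn
      refine ⟨c, hc, le_antisymm ?_ (hg0 t c)⟩
      refine ge_of_tendsto tendsto_one_div_add_atTop_nhds_zero_nat (Eventually.of_forall fun k => ?_)
      obtain ⟨d, -, hd⟩ := h k
      exact (hmin d.2).trans hd.le
  rw [heq]
  exact MeasurableSet.iInter fun k => MeasurableSet.biUnion hDc fun d _ =>
    measurableSet_lt (hgm d) measurable_const

/-- Measurable selection of zeros of a Carathéodory function over a compact set. -/
lemma exists_measurable_zero_selection {T U : Type*} [MeasurableSpace T] [MetricSpace U]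
    [MeasurableSpace U] [BorelSpace U] {K : Set U} (hK : IsCompact K) (hne : K.Nonempty)
    {g : T → U → ℝ} (hg0 : ∀ t w, 0 ≤ g t w) (hgc : ∀ t, Continuous (g t))
    (hgm : ∀ w, Measurable fun t => g t w) :
    ∃ v : T → U, Measurable v ∧ (∀ t, v t ∈ K) ∧ ∀ t, (∃ w ∈ K, g t w = 0) → g t (v t) = 0 := by
  have : CompactSpace K := isCompact_iff_compactSpace.mp hK
  have : Nonempty K := hne.to_subtype
  -- A continuous surjection from the Cantor set transports the order of `ℝ` to a parametrisation of
  -- `K`; selecting the least parameter of a zero makes the choice canonical and measurable.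
  obtain ⟨κ, hκ, hκs⟩ := exists_nat_bool_continuous_surjective_of_compact K
  have : CompactSpace cantorSet := isCompact_iff_compactSpace.mp isCompact_cantorSet
  set θ : cantorSet → U := fun c => κ (cantorSetHomeomorphNatToBool c) with hθ
  have hθc : Continuous θ :=
    continuous_subtype_val.comp (hκ.comp cantorSetHomeomorphNatToBool.continuous)
  have hθK : ∀ c, θ c ∈ K := fun c => (κ _).2
  have hθs : ∀ w ∈ K, ∃ c, θ c = w := by
    intro w hw
    obtain ⟨b, hb⟩ := hκs ⟨w, hw⟩
    refine ⟨cantorSetHomeomorphNatToBool.symm b, ?_⟩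
    simp [hθ, hb]
  set c₀ : cantorSet := cantorSetHomeomorphNatToBool.symm fun _ => false
  have hex : ∀ t, ∃ c : cantorSet, ((∃ c', g t (θ c') = 0) →
      g t (θ c) = 0 ∧ ∀ c', g t (θ c') = 0 → (c : ℝ) ≤ c') ∧
      ((¬ ∃ c', g t (θ c') = 0) → c = c₀) := by
    intro t
    by_cases hgood : ∃ c', g t (θ c') = 0
    · have hcl : IsClosed {c' | g t (θ c') = 0} :=
        isClosed_eq ((hgc t).comp hθc) continuous_const
      obtain ⟨c, hc, hmin⟩ := hcl.isCompact.exists_isMinOn hgood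
        continuous_subtype_val.continuousOn
      exact ⟨c, fun _ => ⟨hc, fun c' hc' => hmin hc'⟩, fun h => absurd hgood h⟩
    · exact ⟨c₀, fun h => absurd h hgood, fun _ => rfl⟩
  choose c hc hc' using hex
  have hmeas : ∀ Q : Set cantorSet, IsClosed Q → MeasurableSet {t | ∃ c ∈ Q, g t (θ c) = 0} :=
    fun Q hQ => measurableSet_exists_mem_eq_zero hQ.isCompact (fun t c => hg0 t _)
      (fun t => (hgc t).comp hθc) fun c => hgm _
  have hcm : Measurable c := by
    refine Measurable.subtype_mk (f := fun t => (c t : ℝ)) ?_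
    refine measurable_of_Iic fun a => ?_
    have hgoodm := hmeas univ isClosed_univ
    have ham := hmeas {c | (c : ℝ) ≤ a} (isClosed_le continuous_subtype_val continuous_const)
    have heq : (fun t => (c t : ℝ)) ⁻¹' Iic a =
        {t | ∃ c ∈ {c : cantorSet | (c : ℝ) ≤ a}, g t (θ c) = 0} ∪
          ({t | ∃ c ∈ (univ : Set cantorSet), g t (θ c) = 0}ᶜ ∩ {_t | (c₀ : ℝ) ≤ a}) := by
      ext t
      simp only [mem_preimage, mem_Iic, mem_union, mem_inter_iff, mem_compl_iff, mem_ofPred_eq,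
        mem_univ, true_and]
      by_cases hgood : ∃ c', g t (θ c') = 0
      · simp only [hgood, not_true_eq_false, false_and, or_false]
        constructor
        · exact fun h => ⟨c t, h, (hc t hgood).1⟩
        · rintro ⟨d, hd, hd0⟩
          exact ((hc t hgood).2 d hd0).trans hd
      · have h1 : ¬ ∃ d : cantorSet, (d : ℝ) ≤ a ∧ g t (θ d) = 0 :=
          fun ⟨d, _, hd⟩ => hgood ⟨d, hd⟩
        simp only [hgood, h1, not_false_eq_true, true_and, false_or, hc' t hgood]
    rw [heq]
    exact ham.union (hgoodm.compl.inter (MeasurableSet.const _))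
  refine ⟨fun t => θ (c t), hθc.measurable.comp hcm, fun t => hθK _, ?_⟩
  rintro t ⟨w, hw, hw0⟩
  obtain ⟨d, rfl⟩ := hθs w hw
  exact (hc t ⟨d, hw0⟩).1

/-- Continuous linear functionals reduce this to real Lipschitz functions, which are absolutely
continuous. -/
lemma intervalIntegral_eq_sub_of_lipschitzOnWith {F : Type*} [NormedAddCommGroup F]
    [NormedSpace ℝ F] [CompleteSpace F] {Y d : ℝ → F} {a b : ℝ} {C : NNReal} (hab : a ≤ b)
    (hY : LipschitzOnWith C Y (Icc a b)) (hd : ∀ᵐ t, t ∈ Ioo a b → HasDerivAt Y (d t) t)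
    (hint : IntervalIntegrable d volume a b) : ∫ t in a..b, d t = Y b - Y a := by
  refine (SeparatingDual.eq_iff_forall_dual_eq (R := ℝ)).mpr fun L => ?_
  have hLY : LipschitzOnWith (‖L‖₊ * C) (L ∘ Y) (uIcc a b) := by
    rw [uIcc_of_le hab]
    exact L.lipschitz.comp_lipschitzOnWith hY
  have h1 := hLY.absolutelyContinuousOnInterval.integral_deriv_eq_sub
  rw [← L.intervalIntegral_comp_comm hint, map_sub]
  refine Eq.trans (intervalIntegral.integral_congr_ae ?_) h1
  have hb : ∀ᵐ t : ℝ, t ≠ b := by simp [ae_iff, measure_singleton]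
  filter_upwards [hd, hb] with t ht htb hmem
  rw [uIoc_of_le hab] at hmem
  exact (L.hasFDerivAt.comp_hasDerivAt t (ht ⟨hmem.1, hmem.2.lt_of_ne htb⟩)).deriv.symm

/-! ### Euler polygons and proximal aiming -/

namespace ControlProblem

variable {n m : ℕ} {P : ControlProblem n m} {s : ℝ} {z : EuclideanSpace ℝ (Fin n)}

/-- Nodes of an Euler polygon with step size `h` for the state equation augmented by the running
cost, started at time `s` with cost `0` and state `z`. -/
structure IsEulerPolygon (P : ControlProblem n m) (s : ℝ) (z : EuclideanSpace ℝ (Fin n)) (h : ℝ)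
    (Z : ℕ → ℝ × EuclideanSpace ℝ (Fin n)) (v : ℕ → EuclideanSpace ℝ (Fin m)) : Prop where
  step_pos : 0 < h
  initial : Z 0 = (0, z)
  control_mem : ∀ i, v i ∈ P.Ω
  step : ∀ i, Z (i + 1) = Z i + h • P.velocity (s + i * h) (Z i).2 (v i)

namespace IsEulerPolygon

variable {h K B : ℝ} {Z : ℕ → ℝ × EuclideanSpace ℝ (Fin n)} {v : ℕ → EuclideanSpace ℝ (Fin m)}

/-- Discrete Grönwall: each step multiplies `1 + ‖x‖` by at most `1 + K * h ≤ exp (K * h)`. -/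
lemma norm_state_le (hs : 0 ≤ s) (hZ : P.IsEulerPolygon s z h Z v) (hK : 0 ≤ K)
    (hgrowth : ∀ t : ℝ, 0 ≤ t → ∀ x : EuclideanSpace ℝ (Fin n), ∀ u ∈ P.Ω,
      ‖P.velocity t x u‖ ≤ K * (1 + ‖x‖)) (i : ℕ) :
    1 + ‖(Z i).2‖ ≤ (1 + ‖z‖) * Real.exp (K * (i * h)) := by
  have hh := hZ.step_pos
  induction i with
  | zero => simp [hZ.initial]
  | succ i ih =>
    have h1 := (norm_snd_le (P.velocity (s + i * h) (Z i).2 (v i))).trans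
      (hgrowth (s + i * h) (by positivity) (Z i).2 (v i) (hZ.control_mem i))
    have h2 : ‖(Z (i + 1)).2‖ ≤ ‖(Z i).2‖ + h * (K * (1 + ‖(Z i).2‖)) := by
      rw [hZ.step i]
      refine (norm_add_le _ _).trans (add_le_add le_rfl ?_)
      rw [Prod.smul_snd, norm_smul, Real.norm_of_nonneg hh.le]
      gcongr
    have h3 : 1 + K * h ≤ Real.exp (K * h) := by linarith [Real.add_one_le_exp (K * h)]
    calc 1 + ‖(Z (i + 1)).2‖ ≤ (1 + ‖(Z i).2‖) * (1 + K * h) := by linarith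
      _ ≤ ((1 + ‖z‖) * Real.exp (K * (i * h))) * Real.exp (K * h) := by gcongr
      _ = (1 + ‖z‖) * Real.exp (K * ((i + 1 : ℕ) * h)) := by
        rw [mul_assoc, ← Real.exp_add]; push_cast; ring_nf

lemma sub_eq_sum (hZ : P.IsEulerPolygon s z h Z v) {i j : ℕ} (hij : i ≤ j) :
    Z j - Z i = ∑ k ∈ Finset.Ico i j, h • P.velocity (s + k * h) (Z k).2 (v k) := by
  induction j, hij using Nat.le_induction with
  | base => simp
  | succ j hj ih => rw [Finset.sum_Ico_succ_top hj, ← ih, hZ.step j]; abel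

lemma norm_sub_le (hZ : P.IsEulerPolygon s z h Z v) {i j : ℕ} (hij : i ≤ j)
    (hB : ∀ k < j, ‖P.velocity (s + k * h) (Z k).2 (v k)‖ ≤ B) :
    ‖Z j - Z i‖ ≤ B * ((j - i) * h) := by
  rw [hZ.sub_eq_sum hij]
  refine (norm_sum_le_of_le (f := fun k => h • P.velocity (s + k * h) (Z k).2 (v k))
    (n := fun _ => h * B) (Finset.Ico i j) fun k hk => ?_).trans ?_
  · rw [norm_smul, Real.norm_of_nonneg hZ.step_pos.le]
    exact mul_le_mul_of_nonneg_left (hB k (Finset.mem_Ico.mp hk).2) hZ.step_pos.le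
  · rw [Finset.sum_const, Nat.card_Ico, nsmul_eq_mul, Nat.cast_sub hij]
    exact le_of_eq (by ring)

end IsEulerPolygon

/-- Proximal aiming: Euler polygons along which `φ` plus the accumulated cost is almost
non-increasing. -/
lemma exists_isEulerPolygon_le (hP : P.Standing) {φ : ℝ → EuclideanSpace ℝ (Fin n) → ℝ}
    (hφ : ContinuousOn (fun q : ℝ × EuclideanSpace ℝ (Fin n) => φ q.1 q.2) {q | 0 ≤ q.1})
    (hH : ∀ s : ℝ, 0 ≤ s → ∀ z : EuclideanSpace ℝ (Fin n), P.supHJB φ s z ≤ 0)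
    (hs : 0 ≤ s) (z : EuclideanSpace ℝ (Fin n)) {T ε : ℝ} (hT : s ≤ T) (hε : 0 < ε) :
    ∃ (h : ℝ) (Z : ℕ → ℝ × EuclideanSpace ℝ (Fin n)) (v : ℕ → EuclideanSpace ℝ (Fin m)),
      h < ε ∧ P.IsEulerPolygon s z h Z v ∧ ∀ i j : ℕ, i ≤ j → s + j * h ≤ T →
        φ (s + j * h) (Z j).2 + (Z j).1 ≤ φ (s + i * h) (Z i).2 + (Z i).1 + ε := by
  obtain ⟨K, hK, hgrowth⟩ := hP.exists_norm_velocity_le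
  set R := (1 + ‖z‖) * Real.exp (K * (T - s)) with hR
  have hR0 : 0 ≤ R := by positivity
  set B := K * (1 + R) with hB
  -- The chain of steps loses `2 * ε₁` per unit time, and exchanging `V` and `φ` at both ends costs
  -- another `2 * ε₁`.
  set ε₁ := ε / (2 * (T - s) + 2) with hε₁
  have hTs : 0 ≤ T - s := by linarith
  have hε₁pos : 0 < ε₁ := by positivity
  obtain ⟨V, C, hC, hV⟩ := hP.exists_infConvolution hφ (hs.trans hT) hR0 hε₁pos
  have hpolicy : ∀ (t : ℝ) (x : EuclideanSpace ℝ (Fin n)), ∃ w ∈ P.Ω,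
      t ∈ Icc 0 T → ‖x‖ ≤ R → ∀ h : ℝ, 0 < h →
        V (t + h) (x + h • (P.velocity t x w).2) + h * (P.velocity t x w).1 ≤
          V t x + ε₁ * h + C * (1 + B ^ 2) * h ^ 2 := by
    intro t x
    by_cases htx : t ∈ Icc 0 T ∧ ‖x‖ ≤ R
    · obtain ⟨-, τ, y, p, hp, hτ, -, -, hpre, hstep⟩ := hV t htx.1 x htx.2
      -- The control is optimal at `(τ, y)`, where the hypothesis applies to `p`; `hpre` transfers
      -- the inequality to `(t, x)`.
      obtain ⟨w, hw, hwH⟩ := hP.exists_preHamiltonian_eq_hamiltonian hτ y p.2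
      refine ⟨w, hw, fun _ _ h hh => ?_⟩
      have h1 := (iSup₂_le_iff.mp (hH τ hτ y)) p hp
      rw [← EReal.coe_zero, EReal.coe_le_coe_iff, ← hwH] at h1
      have h2 := abs_le.mp (hpre w hw)
      have h3 := hstep (t + h) (x + h • (P.velocity t x w).2)
      simp only [add_sub_cancel_left, inner_smul_right, sq_abs, norm_smul,
        Real.norm_of_nonneg hh.le] at h3
      have h4 : ‖(P.velocity t x w).2‖ ≤ B := by
        refine ((norm_snd_le _).trans (hgrowth t htx.1.1 x w hw)).trans ?_
        rw [hB]
        gcongr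
      have h5 : C * (h ^ 2 + (h * ‖(P.velocity t x w).2‖) ^ 2) ≤ C * (h ^ 2 + (h * B) ^ 2) := by
        gcongr
      have h6 : h * (p.1 + P.preHamiltonian t x p.2 w) ≤ h * ε₁ := by
        gcongr; linarith
      rw [preHamiltonian_eq_velocity] at h6
      linarith
    · obtain ⟨w, hw⟩ := hP.controls_nonempty
      exact ⟨w, hw, fun h1 h2 => absurd ⟨h1, h2⟩ htx⟩
  choose w hwΩ hw using hpolicy
  set h := min (ε / 2) (ε₁ / (C * (1 + B ^ 2) + 1)) with hh
  have hhpos : 0 < h := by positivity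
  have hhε : h < ε := (min_le_left _ _).trans_lt (by linarith)
  have hhC : C * (1 + B ^ 2) * h ≤ ε₁ := by
    have h1 : h ≤ ε₁ / (C * (1 + B ^ 2) + 1) := min_le_right _ _
    rw [le_div_iff₀ (by positivity)] at h1
    linarith
  set Z : ℕ → ℝ × EuclideanSpace ℝ (Fin n) := fun i => Nat.rec (0, z)
    (fun i Zi => Zi + h • P.velocity (s + i * h) Zi.2 (w (s + i * h) Zi.2)) i with hZ
  have hEuler : P.IsEulerPolygon s z h Z fun i => w (s + i * h) (Z i).2 :=
    ⟨hhpos, rfl, fun i => hwΩ _ _, fun i => rfl⟩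
  have hbd : ∀ i : ℕ, s + i * h ≤ T → s + i * h ∈ Icc 0 T ∧ ‖(Z i).2‖ ≤ R := by
    intro i hi
    refine ⟨⟨by positivity, hi⟩, ?_⟩
    have h1 := hEuler.norm_state_le hs hK.le hgrowth i
    have h2 : (1 + ‖z‖) * Real.exp (K * (i * h)) ≤ R := by
      rw [hR]
      gcongr
      linarith
    linarith
  refine ⟨h, Z, _, hhε, hEuler, fun i j hij hj => ?_⟩
  have hchain : V (s + j * h) (Z j).2 + (Z j).1 ≤
      V (s + i * h) (Z i).2 + (Z i).1 + 2 * ε₁ * ((j - i) * h) := by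
    induction j, hij using Nat.le_induction with
    | base => simp
    | succ j hij ih =>
      have hj' : s + j * h ≤ T := by push_cast at hj; linarith
      have h1 := ih hj'
      obtain ⟨hjI, hjR⟩ := hbd j hj'
      have h2 := hw (s + j * h) (Z j).2 hjI hjR h hhpos
      have h3 : Z (j + 1) = Z j + h • P.velocity (s + j * h) (Z j).2 (w (s + j * h) (Z j).2) := rfl
      have h4 : s + ((j + 1 : ℕ) : ℝ) * h = s + j * h + h := by push_cast; ring
      rw [h3, h4, Prod.snd_add, Prod.fst_add, Prod.smul_snd, Prod.smul_fst, smul_eq_mul]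
      have h5 : C * (1 + B ^ 2) * h * h ≤ ε₁ * h := by gcongr
      push_cast
      linarith
  have hij' : (i : ℝ) * h ≤ j * h := by gcongr
  have h1 := abs_le.mp (hV _ (hbd i (by linarith)).1 _ (hbd i (by linarith)).2).1
  have h2 := abs_le.mp (hV _ (hbd j hj).1 _ (hbd j hj).2).1
  have h3 : 2 * ε₁ * ((j - i) * h) ≤ 2 * ε₁ * (T - s) := by
    gcongr
    have : 0 ≤ (i : ℝ) * h := by positivity
    linarith
  have h4 : ε₁ * (2 * (T - s) + 2) = ε := by rw [hε₁]; field_simp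
  linarith

end ControlProblem

/-! ### Limits of Euler polygons and existence of a process -/

namespace ControlProblem

variable {n m : ℕ} {P : ControlProblem n m} {s : ℝ} {z : EuclideanSpace ℝ (Fin n)}

/-- The normalised increment of an Euler polygon lies in every closed convex set that contains all
the velocities used in between. -/
lemma IsEulerPolygon.smul_sub_mem {h : ℝ} {Z : ℕ → ℝ × EuclideanSpace ℝ (Fin n)}
    {v : ℕ → EuclideanSpace ℝ (Fin m)} (hZ : P.IsEulerPolygon s z h Z v) {i j : ℕ} (hij : i < j)
    {S : Set (ℝ × EuclideanSpace ℝ (Fin n))} (hS : Convex ℝ S)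
    (hmem : ∀ k, i ≤ k → k < j → P.velocity (s + k * h) (Z k).2 (v k) ∈ S) :
    (((j : ℝ) - i) * h)⁻¹ • (Z j - Z i) ∈ S := by
  have hh := hZ.step_pos
  have hij' : (0 : ℝ) < j - i := sub_pos.mpr (by exact_mod_cast hij)
  rw [hZ.sub_eq_sum hij.le, Finset.smul_sum]
  simp only [smul_smul]
  refine hS.sum_mem (fun k _ => by positivity) ?_ fun k hk =>
    hmem k (Finset.mem_Ico.mp hk).1 (Finset.mem_Ico.mp hk).2
  rw [Finset.sum_const, Nat.card_Ico, nsmul_eq_mul, Nat.cast_sub hij.le]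
  field_simp

/-- A limit of Euler polygons with vanishing step sizes. -/
lemma exists_limit_of_isEulerPolygon (hP : P.Standing) {φ : ℝ → EuclideanSpace ℝ (Fin n) → ℝ}
    (hφ : ContinuousOn (fun q : ℝ × EuclideanSpace ℝ (Fin n) => φ q.1 q.2) {q | 0 ≤ q.1})
    (hs : 0 ≤ s) {h : ℕ → ℝ} {Z : ℕ → ℕ → ℝ × EuclideanSpace ℝ (Fin n)}
    {v : ℕ → ℕ → EuclideanSpace ℝ (Fin m)} (hh : ∀ k : ℕ, h k < 1 / ((k : ℝ) + 1))
    (hZ : ∀ k, P.IsEulerPolygon s z (h k) (Z k) (v k))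
    (hle : ∀ k i j : ℕ, i ≤ j → s + j * h k ≤ s + k →
      φ (s + j * h k) (Z k j).2 + (Z k j).1 ≤
        φ (s + i * h k) (Z k i).2 + (Z k i).1 + 1 / ((k : ℝ) + 1)) :
    ∃ Y : ℝ → ℝ × EuclideanSpace ℝ (Fin n), Y s = (0, z) ∧
      (∀ T, s ≤ T → ∃ B : ℝ, 0 ≤ B ∧ ∀ t t', s ≤ t → t ≤ t' → t' ≤ T →
        ‖Y t' - Y t‖ ≤ B * (t' - t)) ∧
      (∀ t t', s ≤ t → t ≤ t' → φ t' (Y t').2 + (Y t').1 ≤ φ t (Y t).2 + (Y t).1) ∧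
      ∀ t, s ≤ t → ∀ ε : ℝ, 0 < ε → ∃ η : ℝ, 0 < η ∧ ∀ t' ∈ Ioo t (t + η),
        (t' - t)⁻¹ • (Y t' - Y t) ∈ Metric.cthickening ε (P.velocity t (Y t).2 '' P.Ω) := by
  have hpos : ∀ k, 0 < h k := fun k => (hZ k).step_pos
  obtain ⟨K, hK, hgrowth⟩ := hP.exists_norm_velocity_le
  have hbound : ∀ T, s ≤ T → ∃ R B : ℝ, 0 ≤ R ∧ 0 ≤ B ∧ ∀ k i : ℕ, s + i * h k ≤ T →
      ‖(Z k i).2‖ ≤ R ∧ ‖P.velocity (s + i * h k) (Z k i).2 (v k i)‖ ≤ B := by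
    intro T hT
    set R := (1 + ‖z‖) * Real.exp (K * (T - s)) with hR
    refine ⟨R, K * (1 + R), by positivity, by positivity, fun k i hi => ?_⟩
    have h1 := (hZ k).norm_state_le hs hK.le hgrowth i
    have h2 : (1 + ‖z‖) * Real.exp (K * (i * h k)) ≤ R := by
      rw [hR]
      gcongr
      linarith
    have h3 : ‖(Z k i).2‖ ≤ R := by linarith
    have := hpos k
    refine ⟨h3, (hgrowth _ (by positivity) _ _ ((hZ k).control_mem i)).trans ?_⟩
    gcongr
  set idx : ℕ → ℝ → ℕ := fun k t => ⌊(t - s) / h k⌋₊ with hidx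
  have hidx_le : ∀ k t, s ≤ t → idx k t * h k ≤ t - s := fun k t ht => by
    rw [← le_div_iff₀ (hpos k)]
    exact Nat.floor_le (div_nonneg (by linarith) (hpos k).le)
  have hidx_lt : ∀ k t, t - s < (idx k t + 1) * h k := fun k t => by
    rw [← div_lt_iff₀ (hpos k)]
    exact Nat.lt_floor_add_one _
  have hidx_mono : ∀ k t t', t ≤ t' → idx k t ≤ idx k t' := fun k t t' htt =>
    Nat.floor_le_floor (div_le_div_of_nonneg_right (by linarith) (hpos k).le)
  -- A non-principal ultrafilter gives limits at all times simultaneously from boundedness alone, in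
  -- place of an Arzelà–Ascoli subsequence.
  set F : Filter ℕ := (hyperfilter ℕ : Filter ℕ) with hF
  have hFtop : F ≤ atTop := Nat.hyperfilter_le_atTop
  have hone : Tendsto (fun k : ℕ => 1 / ((k : ℝ) + 1)) F (𝓝 0) :=
    tendsto_one_div_add_atTop_nhds_zero_nat.mono_left hFtop
  have hh0 : Tendsto h F (𝓝 0) :=
    squeeze_zero (fun k => (hpos k).le) (fun k => (hh k).le) hone
  have hstep : ∀ T B : ℝ, (∀ k i : ℕ, s + i * h k ≤ T →
      ‖P.velocity (s + i * h k) (Z k i).2 (v k i)‖ ≤ B) → ∀ (k i j : ℕ), i ≤ j →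
      s + j * h k ≤ T → ‖Z k j - Z k i‖ ≤ B * ((j - i) * h k) := by
    intro T B hB k i j hij hj
    refine (hZ k).norm_sub_le hij fun l hl => hB k l ?_
    have : (l : ℝ) * h k ≤ j * h k := by
      have := hpos k
      gcongr
    linarith
  have hlim : ∀ t, ∃ y, s ≤ t → Tendsto (fun k => Z k (idx k t)) F (𝓝 y) := by
    intro t
    by_cases ht : s ≤ t
    · obtain ⟨R, B, -, hB0, hRB⟩ := hbound t ht
      have hmem : ∀ k, Z k (idx k t) ∈ Metric.closedBall ((0, z) : ℝ × _) (B * (t - s)) := by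
        intro k
        have h1 := hidx_le k t ht
        have h2 := hstep t B (fun k i hi => (hRB k i hi).2) k 0 (idx k t) (Nat.zero_le _)
          (by linarith)
        rw [mem_closedBall_iff_norm, ← (hZ k).initial]
        refine h2.trans ?_
        gcongr
        simpa using h1
      obtain ⟨y, -, hy⟩ := (isCompact_closedBall ((0, z) : ℝ × _) (B * (t - s))).ultrafilter_le_nhds
        ((hyperfilter ℕ).map fun k => Z k (idx k t))
        (le_principal_iff.mpr (Ultrafilter.mem_map.mpr (univ_mem' hmem)))
      exact ⟨y, fun _ => hy⟩
    · exact ⟨0, fun h => absurd h ht⟩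
  choose Y hY using hlim
  have htime : ∀ t, s ≤ t → Tendsto (fun k => s + idx k t * h k) F (𝓝 t) := by
    intro t ht
    have h1 : Tendsto (fun k => t - h k) F (𝓝 t) := by simpa using tendsto_const_nhds.sub hh0
    refine tendsto_of_tendsto_of_tendsto_of_le_of_le h1 tendsto_const_nhds (fun k => ?_) fun k => ?_
    · simp only
      linarith [hidx_lt k t]
    · simp only
      linarith [hidx_le k t ht]
  have hlipk : ∀ T B : ℝ, 0 ≤ B → (∀ k i : ℕ, s + i * h k ≤ T →
      ‖P.velocity (s + i * h k) (Z k i).2 (v k i)‖ ≤ B) → ∀ k t t', s ≤ t → t ≤ t' → t' ≤ T →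
      ‖Z k (idx k t') - Z k (idx k t)‖ ≤ B * (t' - t + h k) := by
    intro T B hB0 hB k t t' ht htt htT
    have h1 := hidx_le k t' (ht.trans htt)
    have h2 := hidx_lt k t
    refine (hstep T B hB k _ _ (hidx_mono k t t' htt) (by linarith)).trans ?_
    gcongr
    linarith
  refine ⟨Y, ?_, ?_, ?_, ?_⟩
  · refine tendsto_nhds_unique (hY s le_rfl) ?_
    have : (fun k => Z k (idx k s)) = fun _ => (0, z) := by
      funext k
      simp [hidx, (hZ k).initial]
    rw [this]
    exact tendsto_const_nhds
  · intro T hT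
    obtain ⟨R, B, -, hB0, hRB⟩ := hbound T hT
    refine ⟨B, hB0, fun t t' ht htt htT => ?_⟩
    have h1 := ((hY t' (ht.trans htt)).sub (hY t ht)).norm
    have h2 : Tendsto (fun k => B * (t' - t + h k)) F (𝓝 (B * (t' - t + 0))) :=
      (tendsto_const_nhds.add hh0).const_mul B
    rw [add_zero] at h2
    exact le_of_tendsto_of_tendsto' h1 h2 fun k =>
      hlipk T B hB0 (fun k i hi => (hRB k i hi).2) k t t' ht htt htT
  · intro t t' ht htt
    have hlimφ : ∀ r, s ≤ r → Tendsto (fun k => φ (s + idx k r * h k) (Z k (idx k r)).2 +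
        (Z k (idx k r)).1) F (𝓝 (φ r (Y r).2 + (Y r).1)) := by
      intro r hr
      have h1 := hφ (r, (Y r).2) (hs.trans hr)
      have h2 : Tendsto (fun k => (s + idx k r * h k, (Z k (idx k r)).2)) F
          (𝓝[{q | 0 ≤ q.1}] (r, (Y r).2)) := by
        refine tendsto_nhdsWithin_of_tendsto_nhds_of_eventually_within _
          ((htime r hr).prodMk_nhds ((continuous_snd.tendsto _).comp (hY r hr))) ?_
        refine Eventually.of_forall fun k => ?_
        have := hpos k
        change 0 ≤ s + idx k r * h k
        positivity
      exact (h1.tendsto.comp h2).add ((continuous_fst.tendsto _).comp (hY r hr))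
    have h3 := (hlimφ t ht).add hone
    rw [add_zero] at h3
    refine le_of_tendsto_of_tendsto (hlimφ t' (ht.trans htt)) h3 ?_
    have hk : ∀ᶠ k : ℕ in F, t' - s ≤ k :=
      (tendsto_natCast_atTop_atTop.eventually_ge_atTop (t' - s)).filter_mono hFtop
    filter_upwards [hk] with k hk
    exact hle k _ _ (hidx_mono k t t' htt) (by linarith [hidx_le k t' (ht.trans htt)])
  · intro t ht ε hε
    obtain ⟨R, B, -, hB0, hRB⟩ := hbound (t + 1) (by linarith)
    have hYR : ‖(Y t).2‖ ≤ R := by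
      refine le_of_tendsto' ((continuous_snd.tendsto _).comp (hY t ht)).norm fun k => ?_
      exact (hRB k _ (by linarith [hidx_le k t ht])).1
    obtain ⟨η₁, hη₁, hmod⟩ := hP.exists_velocity_modulus (t + 1) R hε
    -- Nodes between the indices of `t` and `t'` have times within `η` of `t` and states within `η₁
    -- / 4 + 2 * η * B < η₁` of `Y t`. Their velocities thus lie in the `ε`-thickening, which is
    -- closed and convex and so contains the limiting secants.
    set η := min 1 (η₁ / (4 * (B + 1))) with hη
    have hηpos : 0 < η := by positivity
    have hη1 : η ≤ 1 := min_le_left _ _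
    have hηB : η * (4 * (B + 1)) ≤ η₁ := by
      rw [← le_div_iff₀ (by positivity)]
      exact min_le_right _ _
    have hηB0 : 0 ≤ η * B := by positivity
    refine ⟨η, hηpos, fun t' ht' => ?_⟩
    set S := Metric.cthickening ε (P.velocity t (Y t).2 '' P.Ω) with hS
    have ht0 : 0 ≤ t := hs.trans ht
    have hSc : Convex ℝ S := (hP.convex_velocities t ht0 (Y t).2).cthickening ε
    have htt' : 0 < t' - t := sub_pos.mpr ht'.1
    have hst' : s ≤ t' := ht.trans ht'.1.le
    have hlen : Tendsto (fun k => ((idx k t' : ℝ) - idx k t) * h k) F (𝓝 (t' - t)) := by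
      have := (htime t' hst').sub (htime t ht)
      refine this.congr fun k => by ring
    refine Metric.isClosed_cthickening.mem_of_tendsto
      ((hlen.inv₀ htt'.ne').smul ((hY t' hst').sub (hY t ht))) ?_
    have hclose : ∀ᶠ k in F, ‖Z k (idx k t) - Y t‖ < η₁ / 4 := by
      have := (hY t ht).eventually (Metric.ball_mem_nhds _ (show 0 < η₁ / 4 by positivity))
      filter_upwards [this] with k hk
      rwa [dist_eq_norm] at hk
    filter_upwards [hclose, hh0.eventually (gt_mem_nhds hηpos),
      hlen.eventually (lt_mem_nhds htt')] with k hk hkη hklen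
    have hkpos := hpos k
    have hij : idx k t < idx k t' := by
      have := pos_of_mul_pos_left hklen hkpos.le
      exact_mod_cast sub_pos.mp this
    refine (hZ k).smul_sub_mem hij hSc fun l hil hlj => ?_
    have hi : (idx k t : ℝ) * h k ≤ l * h k := by gcongr
    have hj : (l : ℝ) * h k ≤ idx k t' * h k := by gcongr
    have h1 := hidx_le k t' hst'
    have h2 := hidx_lt k t
    have h3 := hidx_le k t ht
    have hlT : s + l * h k ≤ t + 1 := by linarith [ht'.2]
    have hl0 : 0 ≤ s + l * h k := by positivity
    refine Metric.mem_cthickening_of_dist_le _ (P.velocity t (Y t).2 (v k l)) ε _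
      (mem_image_of_mem _ ((hZ k).control_mem l)) ?_
    rw [dist_eq_norm]
    have hηη : 2 * η < η₁ := by linarith
    refine hmod _ ⟨hl0, hlT⟩ t ⟨ht0, by linarith⟩ _ _ (hRB k l hlT).1 hYR ?_ ?_ _
      ((hZ k).control_mem l)
    · rw [abs_lt]
      constructor <;> linarith [ht'.2]
    · have h4 := hstep (t + 1) B (fun k i hi => (hRB k i hi).2) k (idx k t) l hil hlT
      have h5 : B * ((l - idx k t) * h k) ≤ B * (2 * η) :=
        mul_le_mul_of_nonneg_left (by linarith [ht'.2]) hB0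
      have h6 := norm_snd_le (Z k l - Y t)
      have h7 := norm_sub_le_norm_sub_add_norm_sub (Z k l) (Z k (idx k t)) (Y t)
      rw [Prod.snd_sub] at h6
      linarith

theorem nonincreasingAlongSome_of_supHJB_le (hP : P.Standing)
    {φ : ℝ → EuclideanSpace ℝ (Fin n) → ℝ}
    (hφ : ContinuousOn (fun q : ℝ × EuclideanSpace ℝ (Fin n) => φ q.1 q.2) {q | 0 ≤ q.1})
    (hfin : ∀ τ : ℝ, 0 ≤ τ → ∀ z x u, P.IsAdmissible τ z x u →
      (x, u) ∈ P.finiteCostProcesses τ z)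
    (hH : ∀ s : ℝ, 0 ≤ s → ∀ z : EuclideanSpace ℝ (Fin n), P.supHJB φ s z ≤ 0) :
    P.NonincreasingAlongSome φ := by
  intro s hs z
  choose h Z v hh hZ hle using fun k : ℕ =>
    exists_isEulerPolygon_le hP hφ hH hs z (T := s + k) (ε := 1 / ((k : ℝ) + 1))
      (by linarith [Nat.cast_nonneg (α := ℝ) k]) (by positivity)
  obtain ⟨Y, hYs, hYlip, hYle, hYsec⟩ := exists_limit_of_isEulerPolygon hP hφ hs hh hZ hle
  have hlipOn : ∀ T, s ≤ T → ∃ C : NNReal, LipschitzOnWith C Y (Icc s T) := by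
    intro T hT
    obtain ⟨B, hB0, hB⟩ := hYlip T hT
    refine ⟨B.toNNReal, LipschitzOnWith.of_dist_le_mul fun t ht t' ht' => ?_⟩
    rw [Real.coe_toNNReal _ hB0, dist_eq_norm, Real.dist_eq]
    rcases le_total t t' with h1 | h1
    · rw [norm_sub_rev, abs_sub_comm, abs_of_nonneg (by linarith)]
      exact hB t t' ht.1 h1 ht'.2
    · rw [abs_of_nonneg (by linarith)]
      exact hB t' t ht'.1 h1 ht.2
  have hYc : ContinuousOn Y (Ici s) := by
    intro t ht
    obtain ⟨C, hC⟩ := hlipOn (t + 1) (by linarith [mem_Ici.mp ht])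
    refine (hC.continuousOn t ⟨ht, by linarith⟩).mono_of_mem_nhdsWithin ?_
    rw [← Ici_inter_Iic]
    exact inter_mem_nhdsWithin _ (Iic_mem_nhds (by linarith))
  have hdiff : ∀ᵐ t, s < t → DifferentiableAt ℝ Y t := by
    have h1 : ∀ N : ℕ, ∀ᵐ t, t ∈ Icc s (s + N) → DifferentiableWithinAt ℝ Y (Icc s (s + N)) t := by
      intro N
      obtain ⟨C, hC⟩ := hlipOn (s + N) (by linarith [Nat.cast_nonneg (α := ℝ) N])
      exact hC.ae_differentiableWithinAt_of_mem_real
    filter_upwards [ae_all_iff.mpr h1] with t ht hst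
    obtain ⟨N, hN⟩ := exists_nat_gt (t - s)
    exact (ht N ⟨hst.le, by linarith⟩).differentiableAt (Icc_mem_nhds hst (by linarith))
  have hderiv : ∀ t, s < t → DifferentiableAt ℝ Y t →
      ∃ w ∈ P.Ω, P.velocity t (Y t).2 w = deriv Y t := by
    intro t ht hd
    have ht0 : 0 ≤ t := hs.trans ht.le
    have hcomp : IsCompact (P.velocity t (Y t).2 '' P.Ω) :=
      hP.compact_controls.image (hP.continuous_velocity_control ht0 _)
    have hslope : Tendsto (fun t' => (t' - t)⁻¹ • (Y t' - Y t)) (𝓝[>] t) (𝓝 (deriv Y t)) :=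
      (hasDerivAt_iff_tendsto_slope.mp hd.hasDerivAt).mono_left
        (nhdsWithin_mono _ fun _ h => ne_of_gt h)
    -- Secants lie in every thickening of the velocity set, hence so does the derivative; the
    -- velocity set is compact and thus equals the intersection.
    have hmem : deriv Y t ∈ closure (P.velocity t (Y t).2 '' P.Ω) := by
      rw [Metric.closure_eq_iInter_cthickening, mem_iInter₂]
      intro ε hε
      obtain ⟨η, hη, hsec⟩ := hYsec t ht.le ε hε
      refine Metric.isClosed_cthickening.mem_of_tendsto hslope ?_
      filter_upwards [Ioo_mem_nhdsGT (show t < t + η by linarith)] with t' ht'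
      exact hsec t' ht'
    rw [hcomp.isClosed.closure_eq] at hmem
    exact hmem
  -- Clamping time extends the data continuously to all of `ℝ`, as the selection lemma requires,
  -- without changing anything after `s`.
  have hYc' : Continuous fun t => Y (max t s) := by
    rw [← continuousOn_univ]
    exact hYc.comp (by fun_prop) fun t _ => le_max_right t s
  obtain ⟨u, hum, huΩ, hu⟩ := exists_measurable_zero_selection hP.compact_controls
    hP.controls_nonempty
    (g := fun t w => ‖P.velocity (max t 0) (Y (max t s)).2 w - deriv Y t‖)
    (fun t w => norm_nonneg _)
    (fun t => ((hP.continuous_velocity_control (le_max_right t 0) _).sub continuous_const).norm)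
    (fun w => by
      refine Measurable.norm (Measurable.sub (Continuous.measurable ?_) (measurable_deriv Y))
      rw [← continuousOn_univ]
      exact hP.continuousOn_velocity.comp (f := fun t : ℝ => (max t 0, (Y (max t s)).2, w))
        ((continuous_id.max continuous_const).prodMk
          (hYc'.snd.prodMk continuous_const)).continuousOn fun t _ => le_max_right t 0)
  have huvel : ∀ᵐ t, s < t → P.velocity t (Y t).2 (u t) = deriv Y t := by
    filter_upwards [hdiff] with t ht hst
    obtain ⟨w, hw, hwd⟩ := hderiv t hst (ht hst)
    have h1 := hu t ⟨w, hw, by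
      simp only [max_eq_left hst.le, max_eq_left (hs.trans hst.le), hwd, sub_self, norm_zero]⟩
    simp only [max_eq_left hst.le, max_eq_left (hs.trans hst.le)] at h1
    exact sub_eq_zero.mp (norm_eq_zero.mp h1)
  have hvel_int : ∀ T, s ≤ T → IntegrableOn (fun t => P.velocity t (Y t).2 (u t)) (Icc s T) := by
    intro T hT
    obtain ⟨K, hK, hgrowth⟩ := hP.exists_norm_velocity_le
    obtain ⟨R, hR⟩ := isCompact_Icc.exists_bound_of_continuousOn
      (hYc.mono (Icc_subset_Ici_self : Icc s T ⊆ Ici s))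
    -- Measurability of the velocity along the selected control is inherited from that of `deriv Y`.
    have hae : ∀ᵐ t ∂(volume.restrict (Icc s T)), deriv Y t = P.velocity t (Y t).2 (u t) := by
      rw [ae_restrict_iff' measurableSet_Icc]
      have hne : ∀ᵐ t : ℝ, t ≠ s := by simp [ae_iff, measure_singleton]
      filter_upwards [huvel, hne] with t ht hts hmem
      exact (ht (lt_of_le_of_ne hmem.1 hts.symm)).symm
    refine IntegrableOn.of_bound (by simp) ((measurable_deriv Y).aestronglyMeasurable.congr hae)
      (K * (1 + R)) ?_
    rw [ae_restrict_iff' measurableSet_Icc]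
    refine Eventually.of_forall fun t ht => ?_
    refine (hgrowth t (hs.trans ht.1) _ _ (huΩ t)).trans ?_
    gcongr
    exact (norm_snd_le _).trans (hR t ht)
  have hFTC : ∀ a b, s ≤ a → a ≤ b → ∫ t in a..b, P.velocity t (Y t).2 (u t) = Y b - Y a := by
    intro a b ha hab
    obtain ⟨C, hC⟩ := hlipOn b (ha.trans hab)
    refine intervalIntegral_eq_sub_of_lipschitzOnWith hab (hC.mono (Icc_subset_Icc_left ha)) ?_ ?_
    · filter_upwards [huvel, hdiff] with t h1 h2 ht
      rw [h1 (ha.trans_lt ht.1)]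
      exact (h2 (ha.trans_lt ht.1)).hasDerivAt
    · rw [intervalIntegrable_iff_integrableOn_Icc_of_le hab]
      exact (hvel_int b (ha.trans hab)).mono_set (Icc_subset_Icc_left ha)
  have hint : ∀ a b, s ≤ a → a ≤ b →
      IntervalIntegrable (fun t => P.velocity t (Y t).2 (u t)) volume a b := by
    intro a b ha hab
    rw [intervalIntegrable_iff_integrableOn_Icc_of_le hab]
    exact (hvel_int b (ha.trans hab)).mono_set (Icc_subset_Icc_left ha)
  have hadm : P.IsAdmissible s z (fun t => (Y t).2) u := by
    refine ⟨?_, Eventually.of_forall huΩ, ?_, fun t ht => ?_⟩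
    · obtain ⟨M, hM⟩ := hP.compact_controls.isBounded.exists_norm_le
      refine (locallyIntegrable_const M).mono hum.aestronglyMeasurable
        (Eventually.of_forall fun t => (hM _ (huΩ t)).trans (le_abs_self M)) |>.locallyIntegrableOn _
    · rw [locallyIntegrableOn_iff isClosed_Ici.isLocallyClosed]
      intro k hk hkc
      obtain ⟨T, hT⟩ := hkc.bddAbove
      have h1 := hvel_int (max s T) (le_max_left _ _)
      exact IntegrableOn.mono_set (s := k) h1.snd
        fun t ht => ⟨hk ht, (hT ht).trans (le_max_right _ _)⟩
    · have h1 := congrArg Prod.snd (hFTC s t le_rfl ht)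
      have h2 := (ContinuousLinearMap.snd ℝ ℝ (EuclideanSpace ℝ (Fin n))).intervalIntegral_comp_comm
        (hint s t le_rfl ht)
      simp only [ContinuousLinearMap.coe_snd'] at h2
      rw [← h2, Prod.snd_sub, hYs] at h1
      change (Y t).2 = z + ∫ r in s..t, (P.velocity r (Y r).2 (u r)).2
      rw [h1]
      abel
  have hmem := hfin s hs z _ u hadm
  refine ⟨_, hmem, fun a ha b hb hab => ?_⟩
  have h1 := pathValue_sub φ hmem.2 ha hb
  have h2 := congrArg Prod.fst (hFTC a b ha hab)
  have h3 := (ContinuousLinearMap.fst ℝ ℝ (EuclideanSpace ℝ (Fin n))).intervalIntegral_comp_comm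
    (hint a b ha hab)
  simp only [ContinuousLinearMap.coe_fst'] at h3
  rw [← h3, Prod.fst_sub] at h2
  have h4 : ∫ r in a..b, P.discountedCost (fun t => (Y t).2) u r = (Y b).1 - (Y a).1 := h2
  have h5 := hYle a b ha hab
  simp only at h1 ⊢
  linarith

end ControlProblem

theorem proposition3p1 {n m : ℕ} (P : ControlProblem n m) (hP : P.Standing)
    (φ : ℝ → EuclideanSpace ℝ (Fin n) → ℝ)
    (hφ : ContinuousOn (fun q : ℝ × EuclideanSpace ℝ (Fin n) => φ q.1 q.2) {q | 0 ≤ q.1}) :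
    -- (a)
    (((∀ s : ℝ, 0 < s → ∀ z : EuclideanSpace ℝ (Fin n), 0 ≤ P.infHJB φ s z) →
        P.NondecreasingAlongEvery φ) ∧
      ((∀ τ : ℝ, 0 ≤ τ → ∀ z, (P.finiteCostProcesses τ z).Nonempty) →
        P.NondecreasingAlongEvery φ →
        ∀ s : ℝ, 0 < s → ∀ z : EuclideanSpace ℝ (Fin n), 0 ≤ P.infHJB φ s z)) ∧
    -- (b)
    (((∀ s : ℝ, 0 ≤ s → ∀ z : EuclideanSpace ℝ (Fin n), P.supMaxHJB φ s z ≤ 0) →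
        P.NonincreasingAlongEvery φ) ∧
      ((∀ τ : ℝ, 0 ≤ τ → ∀ z, (P.finiteCostProcesses τ z).Nonempty) →
        P.NonincreasingAlongEvery φ →
        ∀ s : ℝ, 0 ≤ s → ∀ z : EuclideanSpace ℝ (Fin n), P.supMaxHJB φ s z ≤ 0)) ∧
    -- (c)
    ((P.NonincreasingAlongSome φ →
        ∀ s : ℝ, 0 ≤ s → ∀ z : EuclideanSpace ℝ (Fin n), P.supHJB φ s z ≤ 0) ∧
      ((∀ τ : ℝ, 0 ≤ τ → ∀ z x u, P.IsAdmissible τ z x u →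
          (x, u) ∈ P.finiteCostProcesses τ z) →
        (∀ s : ℝ, 0 ≤ s → ∀ z : EuclideanSpace ℝ (Fin n), P.supHJB φ s z ≤ 0) →
        P.NonincreasingAlongSome φ)) := by
  refine ⟨⟨ControlProblem.nondecreasingAlongEvery_of_le_infHJB hP hφ, fun hne h s hs z => ?_⟩,
    ⟨ControlProblem.nonincreasingAlongEvery_of_supMaxHJB_le hP hφ, fun hne h s hs z => ?_⟩,
    ⟨fun h s hs z => ?_, ControlProblem.nonincreasingAlongSome_of_supHJB_le hP hφ⟩⟩
  · exact ControlProblem.le_infHJB_of_nondecreasingAlongEvery hP hne h hs z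
  · exact ControlProblem.supMaxHJB_le_of_nonincreasingAlongEvery hP hne h hs z
  · exact ControlProblem.supHJB_le_of_nonincreasingAlongSome hP h hs z
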